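/- Let $d\in\mathbb{N}$ and $a>0$. For a continuous function $f:\mathbb{R}^d\to\mathbb{R}$ put $\|f\|_a:=\sup_{x\in\mathbb{R}^d}|f(x)|e^{-a|x|}\in[0,\infty]$, where $|x|$ is the Euclidean norm, and let $X_a:=\{f\in C^0(\mathbb{R}^d):\|f\|_a<\infty\}$. For $\lambda>0$ and $u_0\in X_a$, a *classical solution* of $$\partial_t u(t,x)=\Delta u(t,x)-\lambda u(t,x)^3,\qquad t>0,\ x\in\mathbb{R}^d,\tag{1}$$ started from $u_0$ is a continuous function $u:[0,\infty)\times\mathbb{R}^d\to\mathbb{R}$ with $u(0,\cdot)=u_0$ for which $\partial_t u$, $\nabla u$ and $\nabla^2u$ exist and are continuous on $(0,\infty)\times\mathbb{R}^d$ and (1) holds at every point of $(0,\infty)\times\mathbb{R}^d$. Then for every $\lambda>0$ and every $u_0\in X_a$ there is exactly one classical solution $u$ of (1) started from $u_0$. Moreover, for every $t\ge 0$ there is a constant $C_t$, depending only on $t$, $d$ and $a$ (in particular, not on $\lambda$ or $u_0$), such that for all such $\lambda$ and $u_0$ the solution satisfies $u(t,\cdot)\in X_a$ and $$\|u(t,\cdot)\|_a\le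 C_t\,\|u_0\|_a.$$ -/

import Mathlib

open scoped InnerProductSpace

noncomputable section

namespace AllenCahn

/-- The Euclidean space `ℝ^d`. -/
abbrev Space (d : ℕ) : Type := EuclideanSpace ℝ (Fin d)

/-- The weighted norm `‖f‖_a = sup_x |f x| e^{-a|x|}`. It is a real supremum, hence meaningful
only when the weighted function is bounded, i.e. (for continuous `f`) when `f` lies in
`weightedSpace d a`. -/
def weightedNorm {d : ℕ} (a : ℝ) (f : Space d → ℝ) : ℝ :=
  ⨆ x : Space d, |f x| * Real.exp (-a * ‖x‖)

/-- The space `X_a` of continuous functions `f` on `ℝ^d` with `sup_x |f x| e^{-a|x|} < ∞`. -/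
def weightedSpace (d : ℕ) (a : ℝ) : Set (Space d → ℝ) :=
  {f | Continuous f ∧ BddAbove (Set.range fun x : Space d => |f x| * Real.exp (-a * ‖x‖))}

/-- `u` is a classical (global in time) solution of `∂ₜ u = Δ u - lam u³` on `(0,∞) × ℝ^d` started
from `u₀`: it is continuous on `[0,∞) × ℝ^d`, equals `u₀` at time `0`, is of class `C^{1,2}` on
`(0,∞) × ℝ^d` (one derivative in time and two in space, all of them jointly continuous), and
satisfies the equation at every point of `(0,∞) × ℝ^d`. No growth at infinity is prescribed.
The values `u t` for `t < 0` are irrelevant. -/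
structure IsClassicalSolution {d : ℕ} (lam : ℝ) (u₀ : Space d → ℝ) (u : ℝ → Space d → ℝ) :
    Prop where
  continuousOn : ContinuousOn (fun p : ℝ × Space d => u p.1 p.2) (Set.Ici 0 ×ˢ Set.univ)
  initial : ∀ x, u 0 x = u₀ x
  differentiableAt_time : ∀ t, 0 < t → ∀ x, DifferentiableAt ℝ (fun s => u s x) t
  continuousOn_deriv_time :
    ContinuousOn (fun p : ℝ × Space d => deriv (fun s => u s p.2) p.1) (Set.Ioi 0 ×ˢ Set.univ)
  contDiff_space : ∀ t, 0 < t → ContDiff ℝ 2 (u t)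
  continuousOn_fderiv_space :
    ContinuousOn (fun p : ℝ × Space d => fderiv ℝ (u p.1) p.2) (Set.Ioi 0 ×ˢ Set.univ)
  continuousOn_fderiv_fderiv_space :
    ContinuousOn (fun p : ℝ × Space d => fderiv ℝ (fderiv ℝ (u p.1)) p.2)
      (Set.Ioi 0 ×ˢ Set.univ)
  equation : ∀ t, 0 < t → ∀ x,
    deriv (fun s => u s x) t = Laplacian.laplacian (u t) x - lam * u t x ^ 3

end AllenCahn

end

/-! The cubic absorption forces any two solutions to be close inside a large ball, whatever they do
near its boundary. Since `y ^ 3 - z ^ 3 ≥ (y - z) ^ 3 / 4` for `z ≤ y`, a difference `w = u - v` of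
solutions satisfies `∂ₜ w ≤ Δ w - (λ/4) w ^ 3` wherever `w ≥ 0`. The function `B = A R / (R² -
|x|²)` is infinite on `|x| = R` and satisfies `Δ B ≤ (λ/4) B ^ 3` once `A² λ = 8 d + 36`. If `u` and
`v` agree at time `0`, the maximum principle gives `w ≤ B` in the ball (`sub_le_barrier`). At a
fixed `x` the barrier is `O(1/R)`, so `R → ∞` yields uniqueness without any growth condition.

The same estimate drives existence. Replace the cube by a globally Lipschitz function `cutCube N`
that agrees with it on `[-N, N]`; a contraction in a weighted sup norm solves this equation in mild
form (`exists_mild_solution`), and mild solutions are classical (`exists_isRegularSolution`). With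
`c = a² + a d`, the function `M exp (c t) exp (a √(1 + |x|²))` is a supersolution of the heat
equation. Comparison with it uses only the sign of the nonlinearity, so the bound does not depend on
`N` or `λ` (`IsRegularSolution.abs_le`). Hence on a bounded set the truncation is inactive for large
`N`, and the barrier makes the approximations locally uniformly Cauchy. The limit inherits the bound
and the mild equation, and is therefore a classical solution (`exists_cubic_solution`).

Regularity rests on the formula `exp (tΔ) f (x) = 𝔼 f (x + √(2t) Z)` with `Z` standard Gaussian.
Integration by parts puts a derivative on the Gaussian density at the integrable price `1/√(2t)`.
This is done twice, with a restart at a positive time in between. -/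

open MeasureTheory ProbabilityTheory Filter Topology Set

namespace AllenCahn

set_option linter.unusedSectionVars false

/-! ### The standard Gaussian measure: density, moments, integration by parts, sums. -/

section Gaussian

lemma aestronglyMeasurable_of_continuous {X H : Type*} [TopologicalSpace X] [MeasurableSpace X]
    [OpensMeasurableSpace X] [SecondCountableTopology X] [NormedAddCommGroup H] {f : X → H}
    {μ : Measure X} (hf : Continuous f) : AEStronglyMeasurable f μ := by
  have := secondCountableTopologyEither_of_left X H
  exact hf.aestronglyMeasurable

variable {E : Type*} [NormedAddCommGroup E] [InnerProductSpace ℝ E] [FiniteDimensional ℝ E]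
  [MeasurableSpace E] [BorelSpace E]
  {G : Type*} [NormedAddCommGroup G] [NormedSpace ℝ G]

lemma exp_linear_sub_sq_le (b c s : ℝ) (hb : 0 < b) :
    Real.exp (c * s - b * s ^ 2) ≤ Real.exp (c ^ 2 / (2 * b)) * Real.exp (-(b / 2) * s ^ 2) := by
  rw [← Real.exp_add]
  apply Real.exp_le_exp.2
  have h : c ^ 2 / (2 * b) + -(b / 2) * s ^ 2 - (c * s - b * s ^ 2)
      = (c - b * s) ^ 2 / (2 * b) := by
    field_simp
    ring
  have : 0 ≤ (c - b * s) ^ 2 / (2 * b) := by positivity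
  linarith

lemma integrable_exp_linear_sub_sq (b c : ℝ) (hb : 0 < b) :
    Integrable (fun z : E => Real.exp (c * ‖z‖ - b * ‖z‖ ^ 2)) := by
  have h0 : Integrable (fun z : E => Real.exp (-(b / 2) * ‖z‖ ^ 2)) := by
    have := (GaussianFourier.integrable_cexp_neg_mul_sq_norm_add (V := E)
      (b := ((b / 2 : ℝ) : ℂ)) (by simpa using hb) 0 0).norm
    refine this.congr (Eventually.of_forall fun z => ?_)
    simp only [Complex.norm_exp]
    congr 1
    simp [← Complex.ofReal_pow]
  refine (h0.const_mul (Real.exp (c ^ 2 / (2 * b)))).mono' (by fun_prop)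
    (Eventually.of_forall fun z => ?_)
  rw [Real.norm_eq_abs, abs_of_pos (Real.exp_pos _)]
  exact exp_linear_sub_sq_le b c _ hb

/-- The density of the standard Gaussian measure. -/
noncomputable def gaussDensity (z : E) : ℝ :=
  (2 * Real.pi) ^ (-(Module.finrank ℝ E : ℝ) / 2) * Real.exp (-(1 / 2) * ‖z‖ ^ 2)

lemma gaussDensity_nonneg (z : E) : 0 ≤ gaussDensity z := by
  unfold gaussDensity; positivity

lemma continuous_gaussDensity : Continuous (gaussDensity : E → ℝ) := by
  unfold gaussDensity; fun_prop

lemma hasFDerivAt_gaussDensity (z : E) :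
    HasFDerivAt gaussDensity (-(gaussDensity z) • innerSL ℝ z) z := by
  unfold gaussDensity
  have h := (((hasStrictFDerivAt_norm_sq z).hasFDerivAt.const_mul (-(1 / 2) : ℝ)).exp).const_mul
    ((2 * Real.pi) ^ (-(Module.finrank ℝ E : ℝ) / 2))
  refine h.congr_fderiv ?_
  ext v
  simp
  ring

/-- Both measures are finite and have the same characteristic function. The density is what makes
integration by parts possible. -/
lemma stdGaussian_eq_withDensity :
    stdGaussian E = volume.withDensity (fun z => ENNReal.ofReal (gaussDensity z)) := by
  have hint : Integrable (gaussDensity : E → ℝ) := by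
    have := (integrable_exp_linear_sub_sq (E := E) (1 / 2) 0 (by norm_num)).const_mul
      ((2 * Real.pi) ^ (-(Module.finrank ℝ E : ℝ) / 2))
    refine this.congr (Eventually.of_forall fun z => ?_)
    simp only [gaussDensity]
    ring_nf
  have : IsFiniteMeasure
      (volume.withDensity (fun z : E => ENNReal.ofReal (gaussDensity z))) :=
    isFiniteMeasure_withDensity_ofReal hint.2
  apply Measure.ext_of_charFun
  ext t
  rw [charFun_stdGaussian, charFun_apply,
    integral_withDensity_eq_integral_toReal_smul
      continuous_gaussDensity.measurable.ennreal_ofReal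
      (Eventually.of_forall fun z => ENNReal.ofReal_lt_top)]
  have e : ∀ z : E, (ENNReal.ofReal (gaussDensity z)).toReal • Complex.exp (⟪z, t⟫_ℝ * Complex.I)
      = ((2 * Real.pi) ^ (-(Module.finrank ℝ E : ℝ) / 2) : ℝ) *
        Complex.exp (-(1 / 2 : ℂ) * ‖z‖ ^ 2 + Complex.I * ⟪t, z⟫_ℝ) := by
    intro z
    rw [ENNReal.toReal_ofReal (gaussDensity_nonneg z), gaussDensity, Complex.real_smul,
      Complex.exp_add, real_inner_comm]
    push_cast
    ring_nf
  simp_rw [e]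
  rw [integral_const_mul, GaussianFourier.integral_cexp_neg_mul_sq_norm_add (by norm_num)]
  rw [← mul_assoc]
  have h1 : (((2 * Real.pi) ^ (-(Module.finrank ℝ E : ℝ) / 2) : ℝ) : ℂ) *
      ((Real.pi : ℂ) / (1 / 2)) ^ ((Module.finrank ℝ E : ℂ) / 2) = 1 := by
    have : ((Real.pi : ℂ) / (1 / 2)) ^ ((Module.finrank ℝ E : ℂ) / 2)
        = (((2 * Real.pi) ^ ((Module.finrank ℝ E : ℝ) / 2) : ℝ) : ℂ) := by
      rw [Complex.ofReal_cpow (by positivity)]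
      push_cast
      congr 1
      ring
    rw [this, ← Complex.ofReal_mul, ← Real.rpow_add (by positivity)]
    simp [neg_div]
  rw [h1, one_mul]
  congr 1
  rw [Complex.I_sq]
  ring

lemma integral_stdGaussian (f : E → G) :
    ∫ z, f z ∂(stdGaussian E) = ∫ z, gaussDensity z • f z := by
  rw [stdGaussian_eq_withDensity, integral_withDensity_eq_integral_toReal_smul
      continuous_gaussDensity.measurable.ennreal_ofReal
      (Eventually.of_forall fun z => ENNReal.ofReal_lt_top)]
  simp_rw [ENNReal.toReal_ofReal (gaussDensity_nonneg _)]

lemma integrable_exp_stdGaussian_sq (c : ℝ) :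
    Integrable (fun z : E => Real.exp (c * ‖z‖ + ‖z‖ ^ 2 / 4)) (stdGaussian E) := by
  rw [stdGaussian_eq_withDensity, integrable_withDensity_iff_integrable_smul'
      continuous_gaussDensity.measurable.ennreal_ofReal
      (Eventually.of_forall fun z => ENNReal.ofReal_lt_top)]
  simp_rw [ENNReal.toReal_ofReal (gaussDensity_nonneg _)]
  refine ((integrable_exp_linear_sub_sq (E := E) (1 / 4) c (by norm_num)).const_mul
      ((2 * Real.pi) ^ (-(Module.finrank ℝ E : ℝ) / 2))).congr (Eventually.of_forall fun z => ?_)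
  simp only [gaussDensity, smul_eq_mul]
  rw [mul_assoc, ← Real.exp_add]
  ring_nf

lemma integrable_exp_stdGaussian (c : ℝ) :
    Integrable (fun z : E => Real.exp (c * ‖z‖)) (stdGaussian E) := by
  refine (integrable_exp_stdGaussian_sq (E := E) c).mono' (by fun_prop)
    (Eventually.of_forall fun z => ?_)
  rw [Real.norm_eq_abs, abs_of_pos (Real.exp_pos _)]
  apply Real.exp_le_exp.2
  have := sq_nonneg ‖z‖
  linarith

/-- Gaussian integration by parts: averaging against the Gaussian measure is smoothing. -/
lemma hasFDerivAt_integral_stdGaussian {f : E → G} (hf : Continuous f) {K b r : ℝ} (hb : 0 ≤ b)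
    (hK : ∀ x, ‖f x‖ ≤ K * Real.exp (b * ‖x‖)) (hr : 0 < r) (x₀ : E) :
    HasFDerivAt (fun x => ∫ z, f (x + r • z) ∂(stdGaussian E))
      (r⁻¹ • ∫ z, (innerSL ℝ z).smulRight (f (x₀ + r • z)) ∂(stdGaussian E)) x₀ := by
  have hK0 : 0 ≤ K := by
    have := (norm_nonneg _).trans (hK 0)
    simpa using this
  -- Translating `z` by `r⁻¹ • (x - x₀)` moves all the dependence on `x` into the smooth density, so
  -- `f` need only be continuous.
  have e1 : (fun x => ∫ z, f (x + r • z) ∂(stdGaussian E)) =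
      fun x => ∫ z, gaussDensity (z - r⁻¹ • (x - x₀)) • f (x₀ + r • z) := by
    ext x
    rw [integral_stdGaussian, ← integral_sub_right_eq_self _ (r⁻¹ • (x - x₀))]
    congr 1
    ext z
    rw [smul_sub r z, smul_inv_smul₀ hr.ne']
    congr 2
    abel
  rw [e1, ← integral_smul, integral_stdGaussian]
  set A := (2 * Real.pi) ^ (-(Module.finrank ℝ E : ℝ) / 2) with hA
  have hA0 : 0 ≤ A := by positivity
  have key := hasFDerivAt_integral_of_dominated_of_fderiv_le (𝕜 := ℝ) (μ := (volume : Measure E))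
    (F := fun x z => gaussDensity (z - r⁻¹ • (x - x₀)) • f (x₀ + r • z)) (x₀ := x₀)
    (F' := fun x z => r⁻¹ • (gaussDensity (z - r⁻¹ • (x - x₀)) •
      (innerSL ℝ (z - r⁻¹ • (x - x₀))).smulRight (f (x₀ + r • z))))
    -- On this ball the translation has norm at most `1`, which costs only half of the Gaussian
    -- decay: `exp (-|z|²/2)` becomes `exp (1 - |z|²/4)`.
    (s := Metric.ball x₀ r)
    (bound := fun z => (r⁻¹ * A * Real.exp 2 * K * Real.exp (b * ‖x₀‖)) *
      Real.exp ((1 + b * r) * ‖z‖ - (1 / 4) * ‖z‖ ^ 2)) (Metric.ball_mem_nhds _ hr)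
    ?_ ?_ ?_ ?_ ?_ ?_
  · convert key using 1
    congr 1
    ext1 z
    simp only [sub_self, smul_zero, sub_zero]
    rw [smul_comm]
  · refine Eventually.of_forall fun x => aestronglyMeasurable_of_continuous ?_
    have := continuous_gaussDensity (E := E)
    fun_prop
  · refine ((integrable_exp_linear_sub_sq (E := E) (1 / 2) (b * r) (by norm_num)).const_mul
      (A * K * Real.exp (b * ‖x₀‖))).mono' ?_ ?_
    · have := continuous_gaussDensity (E := E)
      exact aestronglyMeasurable_of_continuous (by fun_prop)
    · refine Eventually.of_forall fun z => ?_
      simp only [sub_self, smul_zero, sub_zero]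
      rw [norm_smul, Real.norm_eq_abs, abs_of_nonneg (gaussDensity_nonneg _), gaussDensity, ← hA]
      have h1 : ‖f (x₀ + r • z)‖ ≤ K * (Real.exp (b * ‖x₀‖) * Real.exp (b * r * ‖z‖)) := by
        refine (hK _).trans ?_
        rw [← Real.exp_add]
        gcongr
        have : ‖x₀ + r • z‖ ≤ ‖x₀‖ + r * ‖z‖ := by
          refine (norm_add_le _ _).trans ?_
          rw [norm_smul, Real.norm_eq_abs, abs_of_pos hr]
        nlinarith
      calc _ ≤ A * Real.exp (-(1 / 2) * ‖z‖ ^ 2) *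
            (K * (Real.exp (b * ‖x₀‖) * Real.exp (b * r * ‖z‖))) := by gcongr
        _ = _ := by
          rw [sub_eq_add_neg, Real.exp_add]
          ring_nf
  · have := continuous_gaussDensity (E := E)
    simp only [sub_self, smul_zero, sub_zero]
    refine aestronglyMeasurable_of_continuous ?_
    fun_prop
  · refine Eventually.of_forall fun z x hx => ?_
    set w := r⁻¹ • (x - x₀) with hw
    have hw1 : ‖w‖ ≤ 1 := by
      rw [hw, norm_smul, norm_inv, Real.norm_eq_abs, abs_of_pos hr, inv_mul_le_one₀ hr]
      rw [Metric.mem_ball, dist_eq_norm] at hx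
      exact hx.le
    rw [norm_smul, norm_smul, ContinuousLinearMap.norm_smulRight_apply, innerSL_apply_norm,
      Real.norm_eq_abs, Real.norm_eq_abs, abs_of_pos (inv_pos.2 hr),
      abs_of_nonneg (gaussDensity_nonneg _), gaussDensity, ← hA]
    have h1 : ‖f (x₀ + r • z)‖ ≤ K * (Real.exp (b * ‖x₀‖) * Real.exp (b * r * ‖z‖)) := by
      refine (hK _).trans ?_
      rw [← Real.exp_add]
      gcongr
      have : ‖x₀ + r • z‖ ≤ ‖x₀‖ + r * ‖z‖ := by
        refine (norm_add_le _ _).trans ?_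
        rw [norm_smul, Real.norm_eq_abs, abs_of_pos hr]
      nlinarith
    have h2 : ‖z - w‖ ≤ Real.exp (1 + ‖z‖) := by
      have : ‖z - w‖ ≤ ‖z‖ + ‖w‖ := norm_sub_le _ _
      have := Real.add_one_le_exp (1 + ‖z‖)
      linarith
    have h3 : Real.exp (-(1 / 2) * ‖z - w‖ ^ 2) ≤ Real.exp (1 - (1 / 4) * ‖z‖ ^ 2) := by
      apply Real.exp_le_exp.2
      have : ‖z‖ ≤ ‖z - w‖ + ‖w‖ := by simpa using norm_add_le (z - w) w
      nlinarith [sq_nonneg (‖z - w‖ - ‖w‖), norm_nonneg (z - w), norm_nonneg w, norm_nonneg z]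
    calc _ ≤ r⁻¹ * ((A * Real.exp (1 - (1 / 4) * ‖z‖ ^ 2)) * (Real.exp (1 + ‖z‖) *
          (K * (Real.exp (b * ‖x₀‖) * Real.exp (b * r * ‖z‖))))) := by gcongr
      _ = (r⁻¹ * A * K * Real.exp (b * ‖x₀‖)) * (Real.exp (1 - (1 / 4) * ‖z‖ ^ 2) *
          Real.exp (1 + ‖z‖) * Real.exp (b * r * ‖z‖)) := by ring
      _ = (r⁻¹ * A * K * Real.exp (b * ‖x₀‖)) * (Real.exp 2 *
          Real.exp ((1 + b * r) * ‖z‖ - (1 / 4) * ‖z‖ ^ 2)) := by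
        simp only [← Real.exp_add]
        ring_nf
      _ = _ := by ring
  · exact (integrable_exp_linear_sub_sq (E := E) (1 / 4) _ (by norm_num)).const_mul _
  · refine Eventually.of_forall fun z x hx => ?_
    have h1 : HasFDerivAt (fun x : E => z - r⁻¹ • (x - x₀))
        (-(r⁻¹ • ContinuousLinearMap.id ℝ E)) x := by
      have := (((hasFDerivAt_id (𝕜 := ℝ) x).sub_const x₀).const_smul r⁻¹).const_sub z
      exact this
    have h2 := (hasFDerivAt_gaussDensity (z - r⁻¹ • (x - x₀))).comp x h1
    refine (h2.smul_const (f (x₀ + r • z))).congr_fderiv ?_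
    ext v
    simp [smul_smul]

/-- A sum of independent centred Gaussians is Gaussian and the variances add: the characteristic
functions multiply. This is the source of the semigroup law. -/
lemma map_stdGaussian_prod (α β : ℝ) :
    ((stdGaussian E).prod (stdGaussian E)).map (fun p => α • p.1 + β • p.2) =
      (stdGaussian E).map (fun z => √(α ^ 2 + β ^ 2) • z) := by
  have : IsProbabilityMeasure (((stdGaussian E).prod (stdGaussian E)).map
      (fun p => α • p.1 + β • p.2)) := Measure.isProbabilityMeasure_map (by fun_prop)
  have : IsProbabilityMeasure ((stdGaussian E).map (fun z => √(α ^ 2 + β ^ 2) • z)) :=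
    Measure.isProbabilityMeasure_map (by fun_prop)
  apply Measure.ext_of_charFun
  ext t
  rw [charFun_map_smul, charFun_stdGaussian, charFun_apply,
    integral_map (by fun_prop) (Measurable.aestronglyMeasurable (by fun_prop))]
  have e : ∀ p : E × E, Complex.exp (⟪α • p.1 + β • p.2, t⟫_ℝ * Complex.I) =
      Complex.exp (⟪p.1, α • t⟫_ℝ * Complex.I) * Complex.exp (⟪p.2, β • t⟫_ℝ * Complex.I) := by
    intro p
    rw [← Complex.exp_add, inner_add_left, real_inner_smul_left, real_inner_smul_left,
      real_inner_smul_right, real_inner_smul_right]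
    push_cast
    ring_nf
  simp_rw [e]
  rw [integral_prod_mul (f := fun z : E => Complex.exp (⟪z, α • t⟫_ℝ * Complex.I))
    (g := fun z : E => Complex.exp (⟪z, β • t⟫_ℝ * Complex.I)), ← charFun_apply, ← charFun_apply,
    charFun_stdGaussian, charFun_stdGaussian, ← Complex.exp_add]
  congr 1
  rw [norm_smul, norm_smul, norm_smul]
  norm_cast
  have h := Real.sq_sqrt (show 0 ≤ α ^ 2 + β ^ 2 by positivity)
  rw [mul_pow, mul_pow, mul_pow, Real.norm_eq_abs, Real.norm_eq_abs, Real.norm_eq_abs, sq_abs,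
    sq_abs, sq_abs, h]
  ring

end Gaussian

/-! ### Functions of exponential growth, the heat operator and the Duhamel integral. -/

section Growth

variable {E : Type*} [NormedAddCommGroup E] [InnerProductSpace ℝ E] [FiniteDimensional ℝ E]
  [MeasurableSpace E] [BorelSpace E]
  {G : Type*} [NormedAddCommGroup G] [NormedSpace ℝ G]
  {G' : Type*} [NormedAddCommGroup G'] [NormedSpace ℝ G']
  {P : Type*} [TopologicalSpace P] {Q : Type*} [TopologicalSpace Q]

/-- A jointly continuous family of functions on `E` which grows at most like `exp (b ‖x‖)`,
locally uniformly in the parameter. -/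
structure ExpGrowth (b : ℝ) (F : P → E → G) : Prop where
  nonneg : 0 ≤ b
  cont : Continuous fun q : P × E => F q.1 q.2
  bound : ∀ p, ∃ K, ∀ᶠ q in 𝓝 p, ∀ x, ‖F q x‖ ≤ K * Real.exp (b * ‖x‖)

namespace ExpGrowth

variable {b : ℝ} {F : P → E → G}

lemma cont_right (hF : ExpGrowth b F) (p : P) : Continuous (F p) :=
  hF.cont.comp (by fun_prop : Continuous fun x : E => (p, x))

lemma cont_left (hF : ExpGrowth b F) (x : E) : Continuous fun p => F p x :=
  hF.cont.comp (by fun_prop : Continuous fun p : P => (p, x))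

lemma bound_at (hF : ExpGrowth b F) (p : P) : ∃ K, 0 ≤ K ∧ ∀ x, ‖F p x‖ ≤ K * Real.exp (b * ‖x‖) := by
  obtain ⟨K, hK⟩ := hF.bound p
  have h := hK.self_of_nhds
  refine ⟨K, ?_, h⟩
  simpa using (norm_nonneg _).trans (h 0)

lemma bound_on (hF : ExpGrowth b F) {S : Set P} (hS : IsCompact S) :
    ∃ K, 0 ≤ K ∧ ∀ p ∈ S, ∀ x, ‖F p x‖ ≤ K * Real.exp (b * ‖x‖) := by
  refine hS.induction_on (p := fun S => ∃ K, 0 ≤ K ∧ ∀ p ∈ S, ∀ x, ‖F p x‖ ≤ K * Real.exp (b * ‖x‖))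
    ⟨0, le_rfl, by simp⟩ ?_ ?_ ?_
  · rintro s t hst ⟨K, h0, hK⟩
    exact ⟨K, h0, fun p hp => hK p (hst hp)⟩
  · rintro s t ⟨K, h0, hK⟩ ⟨K', h0', hK'⟩
    refine ⟨max K K', h0.trans (le_max_left _ _), ?_⟩
    rintro p (hp | hp) x
    · exact (hK p hp x).trans (by gcongr; exact le_max_left _ _)
    · exact (hK' p hp x).trans (by gcongr; exact le_max_right _ _)
  · intro p _
    obtain ⟨K, hK⟩ := hF.bound p
    refine ⟨{q | ∀ x, ‖F q x‖ ≤ K * Real.exp (b * ‖x‖)}, mem_nhdsWithin_of_mem_nhds hK, K, ?_,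
      fun q hq => hq⟩
    simpa using (norm_nonneg _).trans (hK.self_of_nhds 0)

lemma mono (hF : ExpGrowth b F) {b' : ℝ} (h : b ≤ b') : ExpGrowth b' F where
  nonneg := hF.nonneg.trans h
  cont := hF.cont
  bound p := by
    obtain ⟨K, hK⟩ := hF.bound p
    refine ⟨K, hK.mono fun q hq x => (hq x).trans ?_⟩
    have : 0 ≤ K := by simpa using (norm_nonneg _).trans (hq 0)
    gcongr

lemma comp (hF : ExpGrowth b F) {φ : Q → P} (hφ : Continuous φ) :
    ExpGrowth b (fun q => F (φ q)) where
  nonneg := hF.nonneg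
  cont := hF.cont.comp (by fun_prop : Continuous fun q : Q × E => (φ q.1, q.2))
  bound q := by
    obtain ⟨K, hK⟩ := hF.bound (φ q)
    exact ⟨K, hφ.continuousAt.eventually hK⟩

lemma add {F' : P → E → G} (hF : ExpGrowth b F) (hF' : ExpGrowth b F') :
    ExpGrowth b (fun p x => F p x + F' p x) where
  nonneg := hF.nonneg
  cont := hF.cont.add hF'.cont
  bound p := by
    obtain ⟨K, hK⟩ := hF.bound p
    obtain ⟨K', hK'⟩ := hF'.bound p
    refine ⟨K + K', ?_⟩
    filter_upwards [hK, hK'] with q h h' x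
    rw [add_mul]
    exact (norm_add_le _ _).trans (add_le_add (h x) (h' x))

lemma smul (hF : ExpGrowth b F) {c : P → ℝ} (hc : Continuous c) :
    ExpGrowth b (fun p x => c p • F p x) where
  nonneg := hF.nonneg
  cont := (hc.comp continuous_fst).smul hF.cont
  bound p := by
    obtain ⟨K, hK⟩ := hF.bound p
    have h1 : ∀ᶠ q in 𝓝 p, |c q| < |c p| + 1 :=
      (continuous_abs.comp hc).continuousAt.eventually_lt continuousAt_const (by simp)
    refine ⟨(|c p| + 1) * K, ?_⟩
    filter_upwards [hK, h1] with q h h' x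
    rw [norm_smul, Real.norm_eq_abs, mul_assoc]
    exact mul_le_mul h'.le (h x) (norm_nonneg _) (by positivity)

lemma clm_comp (hF : ExpGrowth b F) (L : G →L[ℝ] G') : ExpGrowth b (fun p x => L (F p x)) where
  nonneg := hF.nonneg
  cont := L.continuous.comp hF.cont
  bound p := by
    obtain ⟨K, hK⟩ := hF.bound p
    refine ⟨‖L‖ * K, hK.mono fun q h x => ?_⟩
    rw [mul_assoc]
    exact (L.le_opNorm _).trans (by gcongr; exact h x)

/-- The shape of the pointwise bound for Gaussian averages. -/
lemma norm_shift_le {f : E → G} {K b : ℝ} (hb : 0 ≤ b)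
    (hK : ∀ x, ‖f x‖ ≤ K * Real.exp (b * ‖x‖)) {r R M : ℝ} (hr : |r| ≤ R) {x : E} (hx : ‖x‖ ≤ M)
    (z : E) : ‖f (x + r • z)‖ ≤ K * Real.exp (b * M) * Real.exp (b * R * ‖z‖) := by
  have hK0 : 0 ≤ K := by simpa using (norm_nonneg _).trans (hK 0)
  refine (hK _).trans ?_
  rw [mul_assoc, ← Real.exp_add]
  gcongr
  have h1 : ‖x + r • z‖ ≤ M + R * ‖z‖ := by
    refine (norm_add_le _ _).trans (add_le_add hx ?_)
    rw [norm_smul, Real.norm_eq_abs]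
    gcongr
  nlinarith

lemma integrable_shift (hF : ExpGrowth b F) (p : P) (r : ℝ) (x : E) :
    Integrable (fun z => F p (x + r • z)) (stdGaussian E) := by
  obtain ⟨K, h0, hK⟩ := hF.bound_at p
  refine ((integrable_exp_stdGaussian (E := E) (b * |r|)).const_mul
    (K * Real.exp (b * ‖x‖))).mono' (aestronglyMeasurable_of_continuous ?_)
    (Eventually.of_forall fun z => norm_shift_le hF.nonneg hK le_rfl le_rfl z)
  exact (hF.cont_right p).comp (by fun_prop)

/-- Gaussian averages preserve the growth class. -/
lemma average [FirstCountableTopology P] (hF : ExpGrowth b F) {Ψ : E → G → G'}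
    (hΨ : Continuous fun q : E × G => Ψ q.1 q.2)
    (hΨ' : ∀ z g, ‖Ψ z g‖ ≤ Real.exp ‖z‖ * ‖g‖) {ρ : P → ℝ} (hρ : Continuous ρ) :
    ExpGrowth b (fun p x => ∫ z, Ψ z (F p (x + ρ p • z)) ∂(stdGaussian E)) := by
  -- A shift by `ρ q • z` only costs a factor `exp (R ‖z‖)`, which the Gaussian integrates. Hence
  -- the exponent `b` in `x` is unchanged.
  have key : ∀ p, ∃ K, 0 ≤ K ∧ ∃ R, ∀ᶠ q in 𝓝 p, ∀ x z, ‖Ψ z (F q (x + ρ q • z))‖ ≤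
      K * Real.exp (b * ‖x‖) * Real.exp (R * ‖z‖) := by
    intro p
    obtain ⟨K, hK⟩ := hF.bound p
    have h1 : ∀ᶠ q in 𝓝 p, |ρ q| < |ρ p| + 1 :=
      (continuous_abs.comp hρ).continuousAt.eventually_lt continuousAt_const (by simp)
    refine ⟨K, by simpa using (norm_nonneg _).trans (hK.self_of_nhds 0),
      1 + b * (|ρ p| + 1), ?_⟩
    filter_upwards [hK, h1] with q h h' x z
    refine (hΨ' _ _).trans ?_
    refine (mul_le_mul_of_nonneg_left (norm_shift_le hF.nonneg h h'.le le_rfl z)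
      (Real.exp_pos _).le).trans (le_of_eq ?_)
    rw [add_mul 1, Real.exp_add, one_mul]
    ring
  have hcont : ∀ z, Continuous fun q : P × E => Ψ z (F q.1 (q.2 + ρ q.1 • z)) := by
    intro z
    have h1 : Continuous fun q : P × E => F q.1 (q.2 + ρ q.1 • z) :=
      hF.cont.comp (by fun_prop : Continuous fun q : P × E => (q.1, q.2 + ρ q.1 • z))
    exact hΨ.comp (continuous_const.prodMk h1)
  have hmeas : ∀ p x, AEStronglyMeasurable (fun z => Ψ z (F p (x + ρ p • z))) (stdGaussian E) := by
    intro p x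
    apply aestronglyMeasurable_of_continuous
    have h1 : Continuous fun z : E => F p (x + ρ p • z) := (hF.cont_right p).comp (by fun_prop)
    exact hΨ.comp (continuous_id.prodMk h1)
  refine ⟨hF.nonneg, ?_, ?_⟩
  · rw [continuous_iff_continuousAt]
    rintro ⟨p, x⟩
    obtain ⟨K, h0, R, hK⟩ := key p
    refine continuousAt_of_dominated
      (bound := fun z => K * Real.exp (b * (‖x‖ + 1)) * Real.exp (R * ‖z‖))
      (Eventually.of_forall fun q => hmeas _ _) ?_
      ((integrable_exp_stdGaussian R).const_mul _)
      (Eventually.of_forall fun z => (hcont z).continuousAt)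
    have h1 : ∀ᶠ q : P × E in 𝓝 (p, x), ‖q.2‖ < ‖x‖ + 1 :=
      (by fun_prop : Continuous fun q : P × E => ‖q.2‖).continuousAt.eventually_lt
        continuousAt_const (by simp)
    filter_upwards [h1, continuousAt_fst.eventually hK] with q hq hq'
    refine Eventually.of_forall fun z => (hq' q.2 z).trans ?_
    have := hF.nonneg
    gcongr
  · intro p
    obtain ⟨K, h0, R, hK⟩ := key p
    refine ⟨K * ∫ z, Real.exp (R * ‖z‖) ∂(stdGaussian E), hK.mono fun q hq x => ?_⟩
    refine (norm_integral_le_of_norm_le ((integrable_exp_stdGaussian R).const_mul _)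
      (Eventually.of_forall (hq x))).trans (le_of_eq ?_)
    rw [integral_const_mul]
    ring

lemma integral [FirstCountableTopology P] {F : P × ℝ → E → G} (hF : ExpGrowth b F) :
    ExpGrowth b (fun p x => ∫ θ in (0 : ℝ)..1, F (p, θ) x) where
  nonneg := hF.nonneg
  cont := by
    apply intervalIntegral.continuous_parametric_intervalIntegral_of_continuous'
    exact hF.cont.comp (by fun_prop : Continuous fun q : (P × E) × ℝ => ((q.1.1, q.2), q.1.2))
  bound p := by
    have : ∃ K, ∀ᶠ q in 𝓝 p, ∀ θ ∈ Icc (0 : ℝ) 1, ∀ x, ‖F (q, θ) x‖ ≤ K * Real.exp (b * ‖x‖) := by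
      refine (isCompact_Icc (a := (0 : ℝ)) (b := 1)).induction_on (p := fun s =>
        ∃ K, ∀ᶠ q in 𝓝 p, ∀ θ ∈ s, ∀ x, ‖F (q, θ) x‖ ≤ K * Real.exp (b * ‖x‖)) ⟨0, by simp⟩ ?_ ?_ ?_
      · rintro s t hst ⟨K, hK⟩
        exact ⟨K, hK.mono fun q h θ hθ => h θ (hst hθ)⟩
      · rintro s t ⟨K, hK⟩ ⟨K', hK'⟩
        refine ⟨max K K', ?_⟩
        filter_upwards [hK, hK'] with q h h'
        rintro θ (hθ | hθ) x
        · exact (h θ hθ x).trans (by gcongr; exact le_max_left _ _)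
        · exact (h' θ hθ x).trans (by gcongr; exact le_max_right _ _)
      · intro θ _
        obtain ⟨K, hK⟩ := hF.bound (p, θ)
        rw [nhds_prod_eq, eventually_prod_iff] at hK
        obtain ⟨pa, ha, pb, hb, hab⟩ := hK
        exact ⟨{η | pb η}, mem_nhdsWithin_of_mem_nhds hb, K,
          ha.mono fun q hq η hη => hab hq hη⟩
    obtain ⟨K, hK⟩ := this
    refine ⟨K, hK.mono fun q hq x => ?_⟩
    have := intervalIntegral.norm_integral_le_of_norm_le_const (a := (0 : ℝ)) (b := 1)
      (f := fun θ => F (q, θ) x) (C := K * Real.exp (b * ‖x‖)) (fun θ hθ => hq θ ?_ x)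
    · simpa using this
    · rw [uIoc_of_le zero_le_one] at hθ
      exact ⟨hθ.1.le, hθ.2⟩

end ExpGrowth

/-- The heat operator: average of `f` against the Gaussian of standard deviation `r`. -/
noncomputable def heat (r : ℝ) (f : E → G) (x : E) : G :=
  ∫ z, f (x + r • z) ∂(stdGaussian E)

/-- The Gaussian average giving `r` times the gradient of `heat r f`. -/
noncomputable def heatGrad (r : ℝ) (f : E → G) (x : E) : E →L[ℝ] G :=
  ∫ z, (innerSL ℝ z).smulRight (f (x + r • z)) ∂(stdGaussian E)

/-- The Duhamel integral `∫₀ᵗ exp((t - s)Δ) F(s) ds`, in the variable `s = t (1 - θ²)`. -/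
noncomputable def duhamel (F : ℝ → E → G) (t : ℝ) (x : E) : G :=
  ∫ θ in (0 : ℝ)..1, (2 * t * θ) • heat (√(2 * t) * θ) (F (t * (1 - θ ^ 2))) x

/-- The gradient of the Duhamel integral. -/
noncomputable def duhamelGrad (F : ℝ → E → G) (t : ℝ) (x : E) : E →L[ℝ] G :=
  ∫ θ in (0 : ℝ)..1, √(2 * t) • heatGrad (√(2 * t) * θ) (F (t * (1 - θ ^ 2))) x

variable {b : ℝ} {F : P → E → G}

lemma ExpGrowth.to_heat [FirstCountableTopology P] (hF : ExpGrowth b F) {ρ : P → ℝ}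
    (hρ : Continuous ρ) : ExpGrowth b (fun p => heat (ρ p) (F p)) :=
  hF.average (Ψ := fun _ g => g) continuous_snd
    (fun _ _ => le_mul_of_one_le_left (norm_nonneg _) (Real.one_le_exp (norm_nonneg _))) hρ

lemma ExpGrowth.to_heatGrad [FirstCountableTopology P] (hF : ExpGrowth b F) {ρ : P → ℝ}
    (hρ : Continuous ρ) : ExpGrowth b (fun p => heatGrad (ρ p) (F p)) := by
  refine hF.average (Ψ := fun z g => (innerSL ℝ z).smulRight g) ?_ (fun z g => ?_) hρ
  · fun_prop
  · rw [ContinuousLinearMap.norm_smulRight_apply, innerSL_apply_norm]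
    gcongr
    linarith [Real.add_one_le_exp ‖z‖]

lemma ExpGrowth.to_duhamel {F : ℝ → E → G} (hF : ExpGrowth b F) : ExpGrowth b (duhamel F) := by
  have h1 : ExpGrowth b (fun q : ℝ × ℝ => F (q.1 * (1 - q.2 ^ 2))) := hF.comp (by fun_prop)
  have h2 := h1.to_heat (ρ := fun q : ℝ × ℝ => √(2 * q.1) * q.2) (by fun_prop)
  exact (h2.smul (c := fun q : ℝ × ℝ => 2 * q.1 * q.2) (by fun_prop)).integral

lemma ExpGrowth.to_duhamelGrad {F : ℝ → E → G} (hF : ExpGrowth b F) :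
    ExpGrowth b (duhamelGrad F) := by
  have h1 : ExpGrowth b (fun q : ℝ × ℝ => F (q.1 * (1 - q.2 ^ 2))) := hF.comp (by fun_prop)
  have h2 := h1.to_heatGrad (ρ := fun q : ℝ × ℝ => √(2 * q.1) * q.2) (by fun_prop)
  exact (h2.smul (c := fun q : ℝ × ℝ => √(2 * q.1)) (by fun_prop)).integral

lemma heat_zero [CompleteSpace G] (f : E → G) (x : E) : heat 0 f x = f x := by
  simp [heat]

lemma duhamel_zero (F : ℝ → E → G) (x : E) : duhamel F 0 x = 0 := by
  simp [duhamel]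

/-- The heat operator is smoothing. -/
lemma ExpGrowth.hasFDerivAt_heat (hF : ExpGrowth b F) (p : P) {r : ℝ} (hr : 0 < r) (x : E) :
    HasFDerivAt (heat r (F p)) (r⁻¹ • heatGrad r (F p) x) x := by
  obtain ⟨K, -, hK⟩ := hF.bound_at p
  exact hasFDerivAt_integral_stdGaussian (hF.cont_right p) hF.nonneg hK hr x

/-- The heat operator commutes with differentiation. -/
lemma ExpGrowth.hasFDerivAt_heat_of_hasFDerivAt (hF : ExpGrowth b F) {b' : ℝ}
    {F' : P → E → E →L[ℝ] G} (hF' : ExpGrowth b' F') (p : P) (h : ∀ x, HasFDerivAt (F p) (F' p x) x) (r : ℝ) (x : E) :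
    HasFDerivAt (heat r (F p)) (heat r (F' p) x) x := by
  obtain ⟨K, h0, hK⟩ := hF'.bound_at p
  refine hasFDerivAt_integral_of_dominated_of_fderiv_le (𝕜 := ℝ)
    (F' := fun x z => F' p (x + r • z)) (Metric.ball_mem_nhds x one_pos)
    (bound := fun z => K * Real.exp (b' * (‖x‖ + 1)) * Real.exp (b' * |r| * ‖z‖))
    (Eventually.of_forall fun y => (hF.integrable_shift p r y).aestronglyMeasurable)
    (hF.integrable_shift p r x) (hF'.integrable_shift p r x).aestronglyMeasurable
    (Eventually.of_forall fun z y hy => ExpGrowth.norm_shift_le hF'.nonneg hK le_rfl ?_ z)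
    ((integrable_exp_stdGaussian _).const_mul _)
    (Eventually.of_forall fun z y _ => ?_)
  · have := norm_sub_norm_le y x
    rw [Metric.mem_ball, dist_eq_norm] at hy
    linarith
  · have := (h (y + r • z)).comp y ((hasFDerivAt_id (𝕜 := ℝ) y).add_const (r • z))
    rwa [ContinuousLinearMap.comp_id] at this

/-- Differentiation of a parametric integral over the unit interval. -/
lemma hasFDerivAt_integral_unitInterval {b' : ℝ} {Φ : ℝ → E → G} {Φ' : ℝ → E → E →L[ℝ] G}
    (hΦ : ExpGrowth b Φ) (hΦ' : ExpGrowth b' Φ')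
    (h : ∀ θ ∈ Ioc (0 : ℝ) 1, ∀ x, HasFDerivAt (Φ θ) (Φ' θ x) x) (x : E) :
    HasFDerivAt (fun x => ∫ θ in (0 : ℝ)..1, Φ θ x) (∫ θ in (0 : ℝ)..1, Φ' θ x) x := by
  obtain ⟨K, h0, hK⟩ := hΦ'.bound_on (isCompact_Icc (a := (0 : ℝ)) (b := 1))
  have hI : uIoc (0 : ℝ) 1 = Ioc 0 1 := uIoc_of_le zero_le_one
  refine intervalIntegral.hasFDerivAt_integral_of_dominated_of_fderiv_le (𝕜 := ℝ)
    (F := fun x θ => Φ θ x) (F' := fun x θ => Φ' θ x)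
    (Metric.ball_mem_nhds x one_pos) (bound := fun _ => K * Real.exp (b' * (‖x‖ + 1)))
    (Eventually.of_forall fun y => aestronglyMeasurable_of_continuous (hΦ.cont_left y))
    ((hΦ.cont_left x).intervalIntegrable _ _)
    (aestronglyMeasurable_of_continuous (hΦ'.cont_left x))
    (Eventually.of_forall fun θ hθ y hy => ?_) (by simp)
    (Eventually.of_forall fun θ hθ y _ => ?_)
  · rw [hI] at hθ
    refine (hK θ ⟨hθ.1.le, hθ.2⟩ y).trans ?_
    have := norm_sub_norm_le y x
    rw [Metric.mem_ball, dist_eq_norm] at hy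
    have := hΦ'.nonneg
    gcongr
    linarith
  · rw [hI] at hθ
    exact h θ hθ y

section Duhamel

variable {F : ℝ → E → G}

/-- Differentiating the heat operator costs `(√(2t) θ)⁻¹`, and the Jacobian `2 t θ` of `s = t (1 -
θ²)` absorbs it, leaving `√(2t)`. In the variable `s` the integrand would have the singularity `(t -
s)^(-1/2)`; in `θ` it is continuous up to `θ = 0`. -/
lemma ExpGrowth.hasFDerivAt_duhamel (hF : ExpGrowth b F) {t : ℝ} (ht : 0 ≤ t) (x : E) :
    HasFDerivAt (duhamel F t) (duhamelGrad F t x) x := by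
  have h1 : ExpGrowth b (fun θ : ℝ => F (t * (1 - θ ^ 2))) := hF.comp (by fun_prop)
  have h2 := (h1.to_heat (ρ := fun θ : ℝ => √(2 * t) * θ) (by fun_prop)).smul
    (c := fun θ => 2 * t * θ) (by fun_prop)
  have h3 := (h1.to_heatGrad (ρ := fun θ : ℝ => √(2 * t) * θ) (by fun_prop)).smul
    (c := fun θ => √(2 * t)) (by fun_prop)
  refine hasFDerivAt_integral_unitInterval h2 h3 (fun θ hθ y => ?_) x
  rcases ht.eq_or_lt with rfl | ht
  · simpa using hasFDerivAt_const (0 : G) y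
  have hr : 0 < √(2 * t) * θ := mul_pos (by positivity) hθ.1
  refine ((h1.hasFDerivAt_heat θ hr y).const_smul (2 * t * θ)).congr_fderiv ?_
  rw [smul_smul]
  congr 1
  have h4 : √(2 * t) * √(2 * t) = 2 * t := Real.mul_self_sqrt (by positivity)
  rw [← div_eq_mul_inv, div_eq_iff hr.ne', ← mul_assoc, h4]

/-- Here the derivative falls on `F` and not on the kernel, so that the gradient of a mild solution
again solves a mild equation. -/
lemma ExpGrowth.hasFDerivAt_duhamel_of_hasFDerivAt (hF : ExpGrowth b F)
    {b' : ℝ} {F' : ℝ → E → E →L[ℝ] G} (hF' : ExpGrowth b' F') {t : ℝ} (ht : 0 ≤ t)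
    (h : ∀ s, 0 ≤ s → ∀ x, HasFDerivAt (F s) (F' s x) x) (x : E) :
    HasFDerivAt (duhamel F t) (duhamel F' t x) x := by
  have h1 : ExpGrowth b (fun θ : ℝ => F (t * (1 - θ ^ 2))) := hF.comp (by fun_prop)
  have h1' : ExpGrowth b' (fun θ : ℝ => F' (t * (1 - θ ^ 2))) := hF'.comp (by fun_prop)
  have h2 := (h1.to_heat (ρ := fun θ : ℝ => √(2 * t) * θ) (by fun_prop)).smul
    (c := fun θ => 2 * t * θ) (by fun_prop)
  have h3 := (h1'.to_heat (ρ := fun θ : ℝ => √(2 * t) * θ) (by fun_prop)).smul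
    (c := fun θ => 2 * t * θ) (by fun_prop)
  refine hasFDerivAt_integral_unitInterval h2 h3 (fun θ hθ y => ?_) x
  refine (h1.hasFDerivAt_heat_of_hasFDerivAt h1' θ (h _ ?_) _ y).const_smul (2 * t * θ)
  exact mul_nonneg ht (by nlinarith [hθ.1, hθ.2])

lemma duhamel_congr {F F' : ℝ → E → G} {t : ℝ} (ht : 0 ≤ t) (h : ∀ s ∈ Icc 0 t, F s = F' s)
    (x : E) : duhamel F t x = duhamel F' t x := by
  refine intervalIntegral.integral_congr fun θ hθ => ?_
  rw [uIcc_of_le zero_le_one] at hθ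
  have h1 : 0 ≤ 1 - θ ^ 2 := by nlinarith [hθ.1, hθ.2]
  rw [h _ ⟨mul_nonneg ht h1, ?_⟩]
  nlinarith [mul_nonneg ht (sq_nonneg θ)]

lemma ExpGrowth.duhamel_eq_integral (hF : ExpGrowth b F) (t : ℝ) (x : E) (c : ℝ) :
    ∫ θ in (0 : ℝ)..1, (2 * t * θ) • heat (√(2 * (c + t * θ ^ 2))) (F (t * (1 - θ ^ 2))) x
      = ∫ s in (0 : ℝ)..t, heat (√(2 * (c + t - s))) (F s) x := by
  have hc : Continuous fun s => heat (√(2 * (c + t - s))) (F s) x :=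
    (hF.to_heat (ρ := fun s => √(2 * (c + t - s))) (by fun_prop)).cont_left x
  have h1 : ∀ θ : ℝ, HasDerivAt (fun θ : ℝ => t * (1 - θ ^ 2)) (-(2 * t * θ)) θ := by
    intro θ
    have := (((hasDerivAt_id θ).pow 2).const_sub 1).const_mul t
    refine this.congr_deriv ?_
    norm_num
    ring
  have := intervalIntegral.integral_deriv_smul_comp (a := 0) (b := 1)
    (f := fun θ : ℝ => t * (1 - θ ^ 2)) (f' := fun θ => -(2 * t * θ))
    (g := fun s => heat (√(2 * (c + t - s))) (F s) x) (fun θ _ => h1 θ) (by fun_prop) hc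
  simp only [ne_eq, OfNat.ofNat_ne_zero, not_false_eq_true, zero_pow, sub_zero, mul_one, one_pow,
    sub_self, mul_zero, Function.comp_def] at this
  rw [intervalIntegral.integral_symm t 0, ← this, ← intervalIntegral.integral_neg]
  refine intervalIntegral.integral_congr fun θ _ => ?_
  simp only [neg_smul, neg_neg]
  congr 4
  ring

lemma ExpGrowth.duhamel_eq (hF : ExpGrowth b F) {t : ℝ} (ht : 0 ≤ t) (x : E) :
    duhamel F t x = ∫ s in (0 : ℝ)..t, heat (√(2 * (t - s))) (F s) x := by
  have := hF.duhamel_eq_integral t x 0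
  simp only [zero_add] at this
  rw [← this]
  refine intervalIntegral.integral_congr fun θ hθ => ?_
  rw [uIcc_of_le zero_le_one] at hθ
  rw [← mul_assoc, Real.sqrt_mul (mul_nonneg zero_le_two ht) (θ ^ 2), Real.sqrt_sq hθ.1]

end Duhamel

/-- The semigroup property. -/
lemma ExpGrowth.heat_heat (hF : ExpGrowth b F) (p : P) (α β : ℝ) (x : E) :
    heat α (heat β (F p)) x = heat (√(α ^ 2 + β ^ 2)) (F p) x := by
  have hc := hF.cont_right p
  have e1 : heat (√(α ^ 2 + β ^ 2)) (F p) x = ∫ y, F p (x + y)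
      ∂(stdGaussian E).map (fun z => √(α ^ 2 + β ^ 2) • z) := by
    rw [integral_map (by fun_prop) (aestronglyMeasurable_of_continuous (by fun_prop))]
    rfl
  rw [e1, ← map_stdGaussian_prod, integral_map (by fun_prop)
    (aestronglyMeasurable_of_continuous (by fun_prop)), integral_prod]
  · simp only [heat, add_assoc]
  · obtain ⟨K, h0, hK⟩ := hF.bound_at p
    have h1 := ((integrable_exp_stdGaussian (E := E) (b * |α|)).mul_prod
      (integrable_exp_stdGaussian (E := E) (b * |β|))).const_mul (K * Real.exp (b * ‖x‖))
    refine h1.mono' (aestronglyMeasurable_of_continuous (by fun_prop))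
      (Eventually.of_forall fun q => ?_)
    have := ExpGrowth.norm_shift_le hF.nonneg hK (r := β) le_rfl (x := x + α • q.1)
      (M := ‖x‖ + |α| * ‖q.1‖) ((norm_add_le _ _).trans (by rw [norm_smul, Real.norm_eq_abs])) q.2
    rw [add_assoc] at this
    refine this.trans (le_of_eq ?_)
    rw [mul_add, Real.exp_add]
    ring_nf

/-- Fubini, then the semigroup law: the variances `2 h` and `2 (r - s)` add up. -/
lemma ExpGrowth.heat_duhamel {F : ℝ → E → G} (hF : ExpGrowth b F) {r h : ℝ} (hr : 0 ≤ r)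
    (hh : 0 ≤ h) (x : E) :
    heat (√(2 * h)) (duhamel F r) x =
      ∫ s in (0 : ℝ)..r, heat (√(2 * (h + r - s))) (F s) x := by
  have hΦ := hF.to_heat (ρ := fun s => √(2 * (r - s))) (by fun_prop)
  have e1 : heat (√(2 * h)) (duhamel F r) x =
      ∫ z, (∫ s in (0 : ℝ)..r, heat (√(2 * (r - s))) (F s) (x + √(2 * h) • z))
        ∂(stdGaussian E) := by
    simp only [heat]
    congr 1
    ext1 z
    exact hF.duhamel_eq hr _
  obtain ⟨K, h0, hK⟩ := hΦ.bound_on (isCompact_Icc (a := (0 : ℝ)) (b := r))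
  rw [e1]
  simp_rw [intervalIntegral.integral_of_le hr]
  rw [integral_integral_swap]
  · refine setIntegral_congr_fun measurableSet_Ioc fun s hs => ?_
    have := hF.heat_heat s (√(2 * h)) (√(2 * (r - s))) x
    rw [Real.sq_sqrt (by linarith), Real.sq_sqrt (by linarith [hs.2]), ← mul_add,
      ← add_sub_assoc] at this
    exact this
  · have h1 := ((integrable_exp_stdGaussian (E := E) (b * |√(2 * h)|)).mul_prod
      (integrable_const (μ := volume.restrict (Ioc (0 : ℝ) r)) (1 : ℝ))).const_mul
        (K * Real.exp (b * ‖x‖))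
    refine h1.mono' (aestronglyMeasurable_of_continuous ?_) ?_
    · exact hΦ.cont.comp (by fun_prop :
        Continuous fun q : E × ℝ => (q.2, x + √(2 * h) • q.1))
    · have : ∀ᵐ q : E × ℝ ∂(stdGaussian E).prod (volume.restrict (Ioc (0 : ℝ) r)),
          q.2 ∈ Ioc (0 : ℝ) r :=
        Measure.quasiMeasurePreserving_snd.ae (ae_restrict_mem measurableSet_Ioc)
      filter_upwards [this] with q hq
      rw [mul_one]
      exact ExpGrowth.norm_shift_le hΦ.nonneg (hK q.2 ⟨hq.1.le, hq.2⟩) le_rfl le_rfl q.1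

/-- Restarting the mild formulation at a later time. -/
lemma ExpGrowth.mild_restart {F : ℝ → E → G} (hF : ExpGrowth b F) {b' : ℝ} {u : ℝ → E → G}
    (hu : ExpGrowth b' u)
    (h : ∀ t, 0 ≤ t → ∀ x, u t x = heat (√(2 * t)) (u 0) x + duhamel F t x)
    {r t : ℝ} (hr : 0 ≤ r) (ht : 0 ≤ t) (x : E) :
    u (r + t) x = heat (√(2 * t)) (u r) x +
      duhamel (fun s => F (r + s)) t x := by
  have hFr : ExpGrowth b (fun s => F (r + s)) := hF.comp (by fun_prop)
  have hD := hF.to_duhamel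
  have hH := hu.to_heat (ρ := fun _ => √(2 * r)) continuous_const
  have e1 : heat (√(2 * t)) (u r) x =
      heat (√(2 * t)) (heat (√(2 * r)) (u 0)) x +
        heat (√(2 * t)) (duhamel F r) x := by
    have : u r = fun x => heat (√(2 * r)) (u 0) x + duhamel F r x :=
      funext (h r hr)
    rw [this]
    exact integral_add (hH.integrable_shift 0 _ x) (hD.integrable_shift r _ x)
  have hc : Continuous fun s => heat (√(2 * (r + t - s))) (F s) x :=
    (hF.to_heat (ρ := fun s => √(2 * (r + t - s))) (by fun_prop)).cont_left x
  -- Everything is now a heat evolution up to time `r + t`: the propagated Duhamel term is the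
  -- integral over `[0, r]`, the new one is the integral over `[r, r + t]`.
  rw [e1, hu.heat_heat, hF.heat_duhamel hr ht, hFr.duhamel_eq ht, h _ (by positivity), hF.duhamel_eq
    (by positivity), ← intervalIntegral.integral_add_adjacent_intervals
    (hc.intervalIntegrable 0 r) (hc.intervalIntegrable r (r + t)), add_assoc]
  congr 1
  · rw [Real.sq_sqrt (by positivity), Real.sq_sqrt (by positivity), ← mul_add, add_comm]
  congr 1
  · rw [add_comm r t]
  · have := intervalIntegral.integral_comp_add_left (a := 0) (b := t)
      (fun s => heat (√(2 * (r + t - s))) (F s) x) r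
    rw [add_zero] at this
    rw [← this]
    refine intervalIntegral.integral_congr fun s _ => ?_
    congr 3
    ring

end Growth

/-! ### From mild to classical solutions. -/

section Regularity

variable {E : Type*} [NormedAddCommGroup E] [InnerProductSpace ℝ E] [FiniteDimensional ℝ E]
  [MeasurableSpace E] [BorelSpace E]
  {G : Type*} [NormedAddCommGroup G] [NormedSpace ℝ G]
  {P : Type*} [TopologicalSpace P]

/-- The trace of a bilinear form. -/
noncomputable def lap : (E →L[ℝ] E →L[ℝ] ℝ) →L[ℝ] ℝ :=
  ∑ i, (ContinuousLinearMap.apply ℝ ℝ (stdOrthonormalBasis ℝ E i)).comp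
    (ContinuousLinearMap.apply ℝ (E →L[ℝ] ℝ) (stdOrthonormalBasis ℝ E i))

lemma lap_apply (B : E →L[ℝ] E →L[ℝ] ℝ) :
    lap B = ∑ i, B (stdOrthonormalBasis ℝ E i) (stdOrthonormalBasis ℝ E i) := by
  simp [lap]

/-- The trace of a rank-one form. It turns the vector integration by parts formula into one for the
Laplacian. -/
lemma lap_smulRight (z : E) (l : E →L[ℝ] ℝ) : lap ((innerSL ℝ z).smulRight l) = l z := by
  rw [lap_apply]
  conv_rhs => rw [← (stdOrthonormalBasis ℝ E).sum_repr z, map_sum]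
  simp only [ContinuousLinearMap.smulRight_apply, innerSL_apply_apply,
    _root_.smul_apply, map_smul, OrthonormalBasis.repr_apply_apply]
  exact Finset.sum_congr rfl fun i _ => by rw [real_inner_comm]

lemma ExpGrowth.integrable_smulRight {b : ℝ} {F : P → E → G} (hF : ExpGrowth b F) (p : P) (r : ℝ)
    (x : E) :
    Integrable (fun z => (innerSL ℝ z).smulRight (F p (x + r • z))) (stdGaussian E) := by
  obtain ⟨K, h0, hK⟩ := hF.bound_at p
  have hc := hF.cont_right p
  refine ((integrable_exp_stdGaussian (E := E) (1 + b * |r|)).const_mul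
    (K * Real.exp (b * ‖x‖))).mono' (aestronglyMeasurable_of_continuous (by fun_prop))
    (Eventually.of_forall fun z => ?_)
  rw [ContinuousLinearMap.norm_smulRight_apply, innerSL_apply_norm, add_mul, Real.exp_add, one_mul]
  have h1 := norm_shift_le hF.nonneg hK (r := r) le_rfl (x := x) le_rfl z
  have h2 : ‖z‖ ≤ Real.exp ‖z‖ := by linarith [Real.add_one_le_exp ‖z‖]
  calc _ ≤ Real.exp ‖z‖ * (K * Real.exp (b * ‖x‖) * Real.exp (b * |r| * ‖z‖)) := by gcongr
    _ = _ := by ring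

lemma ExpGrowth.heat_clm_comp {G' : Type*} [NormedAddCommGroup G'] [NormedSpace ℝ G']
    [CompleteSpace G] [CompleteSpace G'] {b : ℝ} {F : P → E → G} (hF : ExpGrowth b F)
    (L : G →L[ℝ] G') (p : P) (r : ℝ) (x : E) :
    heat r (fun y => L (F p y)) x = L (heat r (F p) x) :=
  L.integral_comp_comm (hF.integrable_shift p r x)

variable {b : ℝ} {w : P → E → ℝ} {w' : P → E → E →L[ℝ] ℝ} {w'' : P → E → E →L[ℝ] E →L[ℝ] ℝ}

/-- Gaussian integration by parts for the gradient of a `C²` function. -/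
lemma integral_fderiv_apply_stdGaussian (hw' : ExpGrowth b w') (hw'' : ExpGrowth b w'') (p : P)
    (h : ∀ x, HasFDerivAt (w' p) (w'' p x) x) {r : ℝ} (hr : 0 < r) (x : E) :
    ∫ z, w' p (x + r • z) z ∂(stdGaussian E) = r * heat r (fun y => lap (w'' p y)) x := by
  -- The same derivative computed twice, once on the density and once on `w'`; taking traces gives
  -- the claim.
  have h1 := (hw'.hasFDerivAt_heat p hr x).unique (hw'.hasFDerivAt_heat_of_hasFDerivAt hw'' p h r x)
  have h2 : heatGrad r (w' p) x = r • heat r (w'' p) x := by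
    rw [← h1, smul_inv_smul₀ hr.ne']
  have h3 : ∫ z, lap ((innerSL ℝ z).smulRight (w' p (x + r • z))) ∂(stdGaussian E) =
      lap (heatGrad r (w' p) x) := lap.integral_comp_comm (hw'.integrable_smulRight p r x)
  have h4 : heat r (fun y => lap (w'' p y)) x = lap (heat r (w'' p) x) :=
    hw''.heat_clm_comp lap p r x
  rw [h4, ← smul_eq_mul, ← map_smul, ← h2, ← h3]
  simp only [lap_smulRight]

/-- The derivative is in the standard deviation `r`, not in time. By
`integral_fderiv_apply_stdGaussian` it equals `r` times the average of the Laplacian. -/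
lemma ExpGrowth.hasDerivAt_heat (hw : ExpGrowth b w) (hw' : ExpGrowth b w') (p : P)
    (h : ∀ x, HasFDerivAt (w p) (w' p x) x) (r : ℝ) (x : E) :
    HasDerivAt (fun r => heat r (w p) x) (∫ z, w' p (x + r • z) z ∂(stdGaussian E)) r := by
  obtain ⟨K, h0, hK⟩ := hw'.bound_at p
  have hc := hw'.cont_right p
  refine (hasDerivAt_integral_of_dominated_loc_of_deriv_le (F' := fun r z => w' p (x + r • z) z)
    (s := Metric.ball r 1) (bound := fun z => K * Real.exp (b * ‖x‖) *
      Real.exp ((b * (|r| + 1) + 1) * ‖z‖)) (Metric.ball_mem_nhds r one_pos)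
    (Eventually.of_forall fun s => (hw.integrable_shift p s x).aestronglyMeasurable)
    (hw.integrable_shift p r x) (aestronglyMeasurable_of_continuous (by fun_prop))
    (Eventually.of_forall fun z s hs => ?_) ((integrable_exp_stdGaussian _).const_mul _)
    (Eventually.of_forall fun z s _ => ?_)).2
  · have hs' : |s| ≤ |r| + 1 := by
      rw [Metric.mem_ball, Real.dist_eq] at hs
      have := abs_sub_abs_le_abs_sub s r
      linarith
    have h1 := norm_shift_le hw'.nonneg hK hs' (x := x) le_rfl z
    have h2 : ‖z‖ ≤ Real.exp ‖z‖ := by linarith [Real.add_one_le_exp ‖z‖]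
    refine (ContinuousLinearMap.le_opNorm _ _).trans ?_
    rw [add_mul, Real.exp_add, one_mul, ← mul_assoc]
    gcongr
  · have h1 : HasDerivAt (fun s : ℝ => x + s • z) z s := by
      simpa using ((hasDerivAt_id s).smul_const z).const_add x
    exact (h (x + s • z)).comp_hasDerivAt s h1

/-- The heat semigroup solves the heat equation, in integrated form. -/
lemma heat_eq_add_duhamel (hw : ExpGrowth b w) (hw' : ExpGrowth b w') (hw'' : ExpGrowth b w'')
    (p : P) (h : ∀ x, HasFDerivAt (w p) (w' p x) x) (h' : ∀ x, HasFDerivAt (w' p) (w'' p x) x)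
    {t : ℝ} (ht : 0 ≤ t) (x : E) :
    heat (√(2 * t)) (w p) x = w p x + duhamel (fun _ y => lap (w'' p y)) t x := by
  rcases ht.eq_or_lt with rfl | ht
  · simp [heat_zero, duhamel_zero]
  have hs : 0 < √(2 * t) := by positivity
  have hl : ExpGrowth b (fun (_ : ℝ) y => lap (w'' p y)) :=
    (hw''.clm_comp lap).comp (φ := fun _ : ℝ => p) continuous_const
  have hwp : ExpGrowth b (fun (_ : ℝ) => w p) := hw.comp (φ := fun _ : ℝ => p) continuous_const
  have hc : Continuous fun θ : ℝ => (2 * t * θ) •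
      heat (√(2 * t) * θ) (fun y => lap (w'' p y)) x :=
    ((hl.to_heat (ρ := fun θ => √(2 * t) * θ) (by fun_prop)).smul
      (c := fun θ => 2 * t * θ) (by fun_prop)).cont_left x
  have hc' : Continuous fun θ : ℝ => heat (√(2 * t) * θ) (w p) x :=
    (hwp.to_heat (ρ := fun θ => √(2 * t) * θ) (by fun_prop)).cont_left x
  -- The Duhamel integrand is exactly the `θ`-derivative of `heat (√(2 * t) * θ) (w p) x`.
  -- Integration by parts needs `θ > 0`; continuity covers the endpoint.
  have key := intervalIntegral.integral_eq_sub_of_hasDerivAt_of_le zero_le_one hc'.continuousOn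
    (f' := fun θ : ℝ => (2 * t * θ) • heat (√(2 * t) * θ) (fun y => lap (w'' p y)) x)
    (fun θ hθ => ?_) (hc.intervalIntegrable 0 1)
  · rw [duhamel, key, mul_one, mul_zero, heat_zero]
    ring
  · have hr : 0 < √(2 * t) * θ := mul_pos hs hθ.1
    have h1 := hw.hasDerivAt_heat hw' p h (√(2 * t) * θ) x
    rw [integral_fderiv_apply_stdGaussian hw' hw'' p h' hr] at h1
    have h2 := h1.comp θ ((hasDerivAt_id θ).const_mul (√(2 * t)))
    refine h2.congr_deriv ?_
    have h4 : √(2 * t) * √(2 * t) = 2 * t := Real.mul_self_sqrt (by positivity)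
    rw [smul_eq_mul]
    linear_combination (θ * heat (√(2 * t) * θ) (fun y => lap (w'' p y)) x) * h4

/-- The Duhamel integral is `t` times a factor continuous in `t`, whose value at `0` is `∫ 2θ F(0,
x) dθ = F(0, x)`. The derivative is two-sided because `√` vanishes on negative numbers, so the
factor is continuous on all of `ℝ`. -/
lemma ExpGrowth.hasDerivAt_duhamel_zero {F : ℝ → E → ℝ} (hF : ExpGrowth b F) (x : E) :
    HasDerivAt (fun t => duhamel F t x) (F 0 x) 0 := by
  have h1 : ExpGrowth b (fun q : ℝ × ℝ => F (q.1 * (1 - q.2 ^ 2))) := hF.comp (by fun_prop)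
  have h2 := (h1.to_heat (ρ := fun q : ℝ × ℝ => √(2 * q.1) * q.2) (by fun_prop)).smul
    (c := fun q => 2 * q.2) (by fun_prop)
  have h3 := h2.integral.cont_left x
  have h4 : ∀ t, duhamel F t x =
      t * ∫ θ in (0 : ℝ)..1, (2 * θ) • heat (√(2 * t) * θ) (F (t * (1 - θ ^ 2))) x := by
    intro t
    rw [duhamel, ← intervalIntegral.integral_const_mul]
    refine intervalIntegral.integral_congr fun θ _ => ?_
    simp only [smul_eq_mul]
    ring
  rw [hasDerivAt_iff_tendsto_slope]
  have h5 := (h3.tendsto 0).mono_left (nhdsWithin_le_nhds (s := {0}ᶜ))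
  have h6 : ∫ θ in (0 : ℝ)..1, (2 * θ) • heat (√(2 * 0) * θ) (F (0 * (1 - θ ^ 2))) x = F 0 x := by
    simp [heat_zero, mul_comm (2 : ℝ)]
  rw [h6] at h5
  refine h5.congr' ?_
  filter_upwards [self_mem_nhdsWithin] with t ht
  rw [slope_def_field, duhamel_zero, h4, sub_zero, sub_zero, mul_div_cancel_left₀ _ ht]

/-- A continuous function with a continuous right derivative is differentiable. -/
lemma hasDerivAt_of_right_deriv {φ D : ℝ → ℝ} (hφ : ContinuousOn φ (Ioi 0))
    (hD : ContinuousOn D (Ioi 0)) (h : ∀ t, 0 < t → HasDerivWithinAt φ (D t) (Ici t) t) {t : ℝ}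
    (ht : 0 < t) : HasDerivAt φ (D t) t := by
  have hsub : ∀ s ∈ Icc (t / 2) (2 * t), s ∈ Ioi (0 : ℝ) := fun s hs =>
    lt_of_lt_of_le (by positivity) hs.1
  have hsub' : ∀ s, t / 2 < s → uIcc (t / 2) s ⊆ Ioi (0 : ℝ) := fun s hs y hy => by
    rw [uIcc_of_le hs.le] at hy
    exact lt_of_lt_of_le (by positivity) hy.1
  have hg : ∀ s, t / 2 < s →
      HasDerivAt (fun s => φ (t / 2) + ∫ y in (t / 2)..s, D y) (D s) s := by
    intro s hs
    have hs0 : s ∈ Ioi (0 : ℝ) := lt_trans (by positivity : (0 : ℝ) < t / 2) hs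
    exact (intervalIntegral.integral_hasDerivAt_right
      (hD.mono (hsub' s hs)).intervalIntegrable
      (hD.stronglyMeasurableAtFilter isOpen_Ioi s hs0)
      (hD.continuousAt (isOpen_Ioi.mem_nhds hs0))).const_add _
  have hg' : HasDerivWithinAt (fun s => φ (t / 2) + ∫ y in (t / 2)..s, D y) (D (t / 2))
      (Ici (t / 2)) (t / 2) := by
    have h0 : t / 2 ∈ Ioi (0 : ℝ) := by simpa using ht
    exact ((intervalIntegral.integral_hasDerivAt_right (by simp)
      (hD.stronglyMeasurableAtFilter isOpen_Ioi _ h0)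
      (hD.continuousAt (isOpen_Ioi.mem_nhds h0))).const_add _).hasDerivWithinAt
  have hgd : ∀ s ∈ Icc (t / 2) (2 * t), HasDerivWithinAt
      (fun s => φ (t / 2) + ∫ y in (t / 2)..s, D y) (D s) (Ici s) s := by
    intro s hs
    rcases hs.1.eq_or_lt with rfl | h1
    · exact hg'
    · exact (hg s h1).hasDerivWithinAt
  have hgc : ContinuousOn (fun s => φ (t / 2) + ∫ y in (t / 2)..s, D y)
      (Icc (t / 2) (2 * t)) := by
    refine continuousOn_const.add ?_
    have := intervalIntegral.continuousOn_primitive_interval (μ := volume) (f := D) (a := t / 2)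
      (b := 2 * t) ?_
    · rwa [uIcc_of_le (by linarith)] at this
    · rw [uIcc_of_le (by linarith)]
      exact (hD.mono hsub).integrableOn_Icc
  -- `φ` and the primitive of `D` agree at `t / 2` and have the same right derivative, hence
  -- coincide; the primitive is differentiable from both sides.
  have heq := eq_of_has_deriv_right_eq (f' := D) (fun s hs => h s (hsub s ⟨hs.1, hs.2.le⟩))
    (fun s hs => hgd s ⟨hs.1, hs.2.le⟩) (hφ.mono hsub) hgc (by simp)
  refine (hg t (by linarith)).congr_of_eventuallyEq ?_
  filter_upwards [Icc_mem_nhds (show t / 2 < t by linarith) (show t < 2 * t by linarith)] with s hs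
  exact heq s hs

/-- Derivatives of solutions are controlled only away from `t = 0`. Their growth is therefore stated
for the shifted families `v (r + max t 0)`, which are defined for all real `t`. -/
lemma ExpGrowth.continuousOn_Ioi {v : ℝ → E → G}
    (h : ∀ r, 0 < r → ExpGrowth b (fun t => v (r + max t 0))) :
    ContinuousOn (fun q : ℝ × E => v q.1 q.2) (Ioi 0 ×ˢ univ) := by
  rintro ⟨t, x⟩ ⟨ht, -⟩
  have ht : 0 < t := ht
  have h1 := ((h (t / 2) (by positivity)).cont.comp
    (by fun_prop : Continuous fun q : ℝ × E => (q.1 - t / 2, q.2))).continuousAt (x := (t, x))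
  refine (h1.congr ?_).continuousWithinAt
  have h2 : ∀ᶠ q : ℝ × E in 𝓝 (t, x), t / 2 < q.1 :=
    continuousAt_const.eventually_lt continuousAt_fst (by simpa using ht)
  filter_upwards [h2] with q hq
  simp only [Function.comp]
  rw [max_eq_left (by linarith)]
  congr 1
  ring

/-- The solution of the mild formulation is differentiable in space. -/
lemma exists_fderiv_of_mild {b' : ℝ} {u F : ℝ → E → G} (hu : ExpGrowth b u) (hF : ExpGrowth b' F)
    (h : ∀ t, 0 ≤ t → ∀ x, u t x = heat (√(2 * t)) (u 0) x + duhamel F t x) :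
    ∃ u' : ℝ → E → E →L[ℝ] G, (∀ t, 0 < t → ∀ x, HasFDerivAt (u t) (u' t x) x) ∧
      ∀ r, 0 < r → ExpGrowth (max b b') (fun t => u' (r + max t 0)) := by
  have hu0 : ExpGrowth b (fun _ : ℝ => u 0) := hu.comp (φ := fun _ => (0 : ℝ)) continuous_const
  refine ⟨fun t x => (√(2 * t))⁻¹ • heatGrad (√(2 * t)) (u 0) x + duhamelGrad F t x, ?_, ?_⟩
  · intro t ht x
    have : u t = fun x => heat (√(2 * t)) (u 0) x + duhamel F t x := funext (h t ht.le)
    rw [this]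
    exact (hu.hasFDerivAt_heat 0 (by positivity) x).add (hF.hasFDerivAt_duhamel ht.le x)
  · intro r hr
    have h1 : ∀ t : ℝ, 0 < r + max t 0 := fun t => add_pos_of_pos_of_nonneg hr (le_max_right _ _)
    have h2 := ((hu0.to_heatGrad (ρ := fun t => √(2 * (r + max t 0))) (by fun_prop)).smul
      (c := fun t => (√(2 * (r + max t 0)))⁻¹) (Continuous.inv₀ (by fun_prop) fun t =>
        (Real.sqrt_pos.2 (mul_pos two_pos (h1 t))).ne')).mono (le_max_left b b')
    have h3 := (hF.to_duhamelGrad.comp (φ := fun t => r + max t 0) (by fun_prop)).mono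
      (le_max_right b b')
    exact h2.add h3

/-- A nonlinearity of degree `n` multiplies the growth exponent by `n`. This is harmless, as
Gaussian averages tolerate any exponent. -/
lemma ExpGrowth.comp_poly {u : P → E → ℝ} (hu : ExpGrowth b u) {φ : ℝ → ℝ} (hφ : Continuous φ)
    {C : ℝ} {n : ℕ} (hC : ∀ y, |φ y| ≤ C * (1 + |y|) ^ n) :
    ExpGrowth (n * b) (fun p x => φ (u p x)) where
  nonneg := mul_nonneg (Nat.cast_nonneg _) hu.nonneg
  cont := hφ.comp hu.cont
  bound p := by
    have hC0 : 0 ≤ C := by simpa using (abs_nonneg _).trans (hC 0)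
    obtain ⟨K, hK⟩ := hu.bound p
    refine ⟨C * (1 + K) ^ n, hK.mono fun q hq x => ?_⟩
    have h1 : 1 + |u q x| ≤ (1 + K) * Real.exp (b * ‖x‖) := by
      have := hq x
      have h2 : 1 ≤ Real.exp (b * ‖x‖) :=
        Real.one_le_exp (mul_nonneg hu.nonneg (norm_nonneg _))
      rw [Real.norm_eq_abs] at this
      linarith
    calc ‖φ (u q x)‖ ≤ C * (1 + |u q x|) ^ n := hC _
      _ ≤ C * ((1 + K) * Real.exp (b * ‖x‖)) ^ n := by gcongr
      _ = _ := by rw [mul_pow, ← Real.exp_nat_mul]; ring_nf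

lemma ExpGrowth.smul_fun {b' : ℝ} {c : P → E → ℝ} {F : P → E → G} (hc : ExpGrowth b c)
    (hF : ExpGrowth b' F) : ExpGrowth (b + b') (fun p x => c p x • F p x) where
  nonneg := add_nonneg hc.nonneg hF.nonneg
  cont := hc.cont.smul hF.cont
  bound p := by
    obtain ⟨K, hK⟩ := hc.bound p
    obtain ⟨K', hK'⟩ := hF.bound p
    refine ⟨K * K', ?_⟩
    filter_upwards [hK, hK'] with q h h' x
    rw [norm_smul, add_mul, Real.exp_add]
    calc _ ≤ (K * Real.exp (b * ‖x‖)) * (K' * Real.exp (b' * ‖x‖)) :=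
          mul_le_mul (h x) (h' x) (norm_nonneg _) ((norm_nonneg _).trans (h x))
      _ = _ := by ring

/-- `u` is of class `C^{1,2}` for positive times and solves `∂ₜ u = Δ u + f(u)`. -/
structure IsRegularSolution (f : ℝ → ℝ) (u : ℝ → E → ℝ) (u' : ℝ → E → E →L[ℝ] ℝ)
    (u'' : ℝ → E → E →L[ℝ] E →L[ℝ] ℝ) : Prop where
  cont : Continuous fun q : ℝ × E => u q.1 q.2
  hasFDerivAt : ∀ t, 0 < t → ∀ x, HasFDerivAt (u t) (u' t x) x
  hasFDerivAt_fderiv : ∀ t, 0 < t → ∀ x, HasFDerivAt (u' t) (u'' t x) x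
  cont_fderiv : ContinuousOn (fun q : ℝ × E => u' q.1 q.2) (Ioi 0 ×ˢ univ)
  cont_fderiv2 : ContinuousOn (fun q : ℝ × E => u'' q.1 q.2) (Ioi 0 ×ˢ univ)
  eqn : ∀ t, 0 < t → ∀ x, HasDerivAt (fun s => u s x) (lap (u'' t x) + f (u t x)) t

/-- Solutions of the mild formulation are classical solutions. -/
theorem exists_isRegularSolution {u : ℝ → E → ℝ} (hu : ExpGrowth b u) {f f' : ℝ → ℝ}
    (hf : ∀ y, HasDerivAt f (f' y) y) (hf' : Continuous f') {C C' : ℝ} {n n' : ℕ}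
    (hC : ∀ y, |f y| ≤ C * (1 + |y|) ^ n) (hC' : ∀ y, |f' y| ≤ C' * (1 + |y|) ^ n')
    (h : ∀ t, 0 ≤ t → ∀ x, u t x = heat (√(2 * t)) (u 0) x + duhamel (fun s y => f (u s y)) t x) :
    ∃ u' u'', IsRegularSolution f u u' u'' := by
  have hfc : Continuous f := continuous_iff_continuousAt.2 fun y => (hf y).continuousAt
  have hF := hu.comp_poly hfc hC
  obtain ⟨u', hd, hg⟩ := exists_fderiv_of_mild hu hF h
  set b₁ := max b (n * b)
  set b₂ := n' * b + b₁
  -- Restarted at `r > 0`, the gradient solves a mild equation with source `f'(u) u'`. The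
  -- first-order result applies to it and gives second derivatives with only one derivative of `f`.
  have hb : ∀ r, 0 < r → ∃ v : ℝ → E → E →L[ℝ] E →L[ℝ] ℝ,
      (∀ t, 0 < t → ∀ x, HasFDerivAt (u' (r + t)) (v t x) x) ∧
      ∀ s, 0 < s → ExpGrowth (max b₁ b₂) (fun t => v (s + max t 0)) := by
    intro r hr
    have hU : ExpGrowth b (fun t => u (r + max t 0)) := hu.comp (by fun_prop)
    have hU' := hg r hr
    have hFt : ExpGrowth (n * b) (fun t y => f (u (r + max t 0) y)) := hU.comp_poly hfc hC
    have hFt' := (hU.comp_poly hf' hC').smul_fun hU'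
    have hd' : ∀ s : ℝ, 0 ≤ s → ∀ x, HasFDerivAt (fun y => f (u (r + max s 0) y))
        (f' (u (r + max s 0) x) • u' (r + max s 0) x) x := by
      intro s hs x
      exact (hf _).comp_hasFDerivAt x (hd _ (by positivity) x)
    have hm : ∀ t : ℝ, 0 ≤ t → ∀ x, u' (r + max t 0) x = heat (√(2 * t)) (u' (r + max 0 0)) x +
        duhamel (fun s y => f' (u (r + max s 0) y) • u' (r + max s 0) y) t x := by
      intro t ht x
      have h1 : u (r + t) = fun x => heat (√(2 * t)) (u (r + max 0 0)) x +
          duhamel (fun s y => f (u (r + max s 0) y)) t x := by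
        ext y
        rw [hF.mild_restart hu h hr.le ht, max_self, add_zero]
        congr 1
        refine duhamel_congr ht (fun s hs => ?_) y
        rw [max_eq_left hs.1]
      have h2 := hd (r + t) (by positivity) x
      rw [h1] at h2
      have h3 := (hU.hasFDerivAt_heat_of_hasFDerivAt hU' 0
        (fun x => by simpa using hd r hr x) (√(2 * t)) x).add
        (hFt.hasFDerivAt_duhamel_of_hasFDerivAt hFt' ht hd' x)
      rw [max_eq_left ht]
      exact h2.unique h3
    obtain ⟨v, hv, hv'⟩ := exists_fderiv_of_mild hU' hFt' hm
    refine ⟨v, fun t ht x => ?_, hv'⟩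
    have := hv t ht x
    rwa [max_eq_left ht.le] at this
  have hd2 : ∀ t, 0 < t → ∀ x, HasFDerivAt (u' t) (fderiv ℝ (u' t) x) x := by
    intro t ht x
    obtain ⟨v, hv, -⟩ := hb (t / 2) (by positivity)
    have := hv (t / 2) (by positivity) x
    rw [add_halves] at this
    exact this.differentiableAt.hasFDerivAt
  have hg2 : ∀ r, 0 < r →
      ExpGrowth (max b₁ b₂) (fun t x => fderiv ℝ (u' (r + max t 0)) x) := by
    intro r hr
    obtain ⟨v, hv, hv'⟩ := hb (r / 2) (by positivity)
    have h1 := hv' (r / 2) (by positivity)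
    convert h1 using 3 with t x
    have h2 := hv (r / 2 + max t 0) (by positivity) x
    rw [← add_assoc, add_halves] at h2
    exact h2.fderiv
  have hc2 := ExpGrowth.continuousOn_Ioi (v := fun t x => fderiv ℝ (u' t) x) hg2
  refine ⟨u', fun t x => fderiv ℝ (u' t) x, hu.cont, hd, hd2,
    ExpGrowth.continuousOn_Ioi hg, hc2, ?_⟩
  intro t ht x
  -- The restart formula only sees later times, so it yields a right derivative; its continuity in
  -- `t` upgrades it.
  refine hasDerivAt_of_right_deriv (D := fun t => lap (fderiv ℝ (u' t) x) + f (u t x))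
    (hu.cont_left x).continuousOn ?_ (fun t ht => ?_) ht
  · refine ContinuousOn.add ?_ (hfc.comp (hu.cont_left x)).continuousOn
    exact lap.continuous.comp_continuousOn (hc2.comp
      (by fun_prop : Continuous fun t : ℝ => (t, x)).continuousOn fun t ht => ⟨ht, mem_univ _⟩)
  · set B := max b₁ b₂
    have hbB : b ≤ B := (le_max_left b (n * b)).trans (le_max_left b₁ b₂)
    have hnB : n * b ≤ B := (le_max_right b (n * b)).trans (le_max_left b₁ b₂)
    have hw : ExpGrowth B (fun _ : ℝ => u t) :=
      (hu.comp (φ := fun _ : ℝ => t) continuous_const).mono hbB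
    have hw' : ExpGrowth B (fun _ : ℝ => u' t) := by
      have := ((hg t ht).comp (φ := fun _ : ℝ => (0 : ℝ)) continuous_const).mono
        (le_max_left b₁ b₂)
      simpa using this
    have hw'' : ExpGrowth B (fun (_ : ℝ) x => fderiv ℝ (u' t) x) := by
      simpa using ((hg2 t ht).comp (φ := fun _ : ℝ => (0 : ℝ)) continuous_const)
    have hFt : ExpGrowth B (fun s y => f (u (t + s) y)) :=
      (hF.comp (φ := fun s => t + s) (by fun_prop)).mono hnB
    have hl := hw''.clm_comp lap
    -- Since `u t` is already `C²`, its heat evolution is also a Duhamel integral. The increment is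
    -- then one Duhamel integral, whose derivative at `s = 0` is its source.
    have hsum : ∀ s, 0 ≤ s → u (t + s) x = u t x +
        duhamel (fun s y => lap (fderiv ℝ (u' t) y) + f (u (t + s) y)) s x := by
      intro s hs
      rw [hF.mild_restart hu h ht.le hs,
        heat_eq_add_duhamel hw hw' hw'' 0 (hd t ht) (hd2 t ht) hs, add_assoc]
      congr 1
      rw [hl.duhamel_eq hs, hFt.duhamel_eq hs, (hl.add hFt).duhamel_eq hs,
        ← intervalIntegral.integral_add]
      · refine intervalIntegral.integral_congr fun θ _ => ?_
        exact (integral_add (hl.integrable_shift 0 _ x) (hFt.integrable_shift θ _ x)).symm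
      · exact ((hl.to_heat (ρ := fun θ => √(2 * (s - θ))) (by fun_prop)).cont_left
          x).intervalIntegrable _ _
      · exact ((hFt.to_heat (ρ := fun θ => √(2 * (s - θ))) (by fun_prop)).cont_left
          x).intervalIntegrable _ _
    have h1 := (hl.add hFt).hasDerivAt_duhamel_zero x
    rw [add_zero] at h1
    have h2 : HasDerivAt (fun s => u t x + duhamel (fun s y => lap (fderiv ℝ (u' t) y) +
        f (u (t + s) y)) (s - t) x) (lap (fderiv ℝ (u' t) x) + f (u t x)) t := by
      have h3 : HasDerivAt (fun s : ℝ => s - t) 1 t := (hasDerivAt_id t).sub_const t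
      have h4 := h1.comp_of_eq t h3 (sub_self t).symm
      rw [mul_one] at h4
      exact h4.const_add (u t x)
    refine h2.hasDerivWithinAt.congr (fun s hs => ?_) ?_
    · rw [← hsum (s - t) (sub_nonneg.2 hs), add_sub_cancel]
    · rw [← hsum (t - t) (by simp), add_sub_cancel]

end Regularity

/-! ### Maximum principle, blow-up barrier and weighted a priori bound. -/

section MaximumPrinciple

variable {E : Type*} [NormedAddCommGroup E] [InnerProductSpace ℝ E] [FiniteDimensional ℝ E]
  [MeasurableSpace E] [BorelSpace E]

/-- `f` is twice differentiable at `x` with Laplacian `l`. -/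
def HasLap (f : E → ℝ) (x : E) (l : ℝ) : Prop :=
  ∃ f' f'', (∀ᶠ y in 𝓝 x, HasFDerivAt f (f' y) y) ∧ HasFDerivAt f' f'' x ∧ lap f'' = l

namespace HasLap

variable {f g : E → ℝ} {x : E} {l m : ℝ}

lemma sub (hf : HasLap f x l) (hg : HasLap g x m) : HasLap (fun y => f y - g y) x (l - m) := by
  obtain ⟨f', f'', h1, h2, rfl⟩ := hf
  obtain ⟨g', g'', h3, h4, rfl⟩ := hg
  refine ⟨fun y => f' y - g' y, f'' - g'', ?_, h2.sub h4, by simp [lap_apply]⟩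
  filter_upwards [h1, h3] with y hy hy'
  exact hy.sub hy'

lemma const_mul (hf : HasLap f x l) (c : ℝ) : HasLap (fun y => c * f y) x (c * l) := by
  obtain ⟨f', f'', h1, h2, rfl⟩ := hf
  refine ⟨fun y => c • f' y, c • f'', ?_, h2.const_smul c, by simp [lap_apply, Finset.mul_sum]⟩
  filter_upwards [h1] with y hy
  exact hy.const_mul c

lemma neg (hf : HasLap f x l) : HasLap (fun y => -f y) x (-l) := by
  simpa using hf.const_mul (-1)

/-- The second derivative test. -/
lemma nonpos_of_isLocalMax (hf : HasLap f x l) (hx : IsLocalMax f x) : l ≤ 0 := by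
  obtain ⟨f', f'', h1, h2, rfl⟩ := hf
  rw [lap_apply]
  refine Finset.sum_nonpos fun i _ => ?_
  set e := stdOrthonormalBasis ℝ E i
  by_contra! hpos
  have hline : ∀ s : ℝ, HasDerivAt (fun s : ℝ => x + s • e) e s := fun s => by
    simpa using ((hasDerivAt_id s).smul_const e).const_add x
  have hcont : Tendsto (fun s : ℝ => x + s • e) (𝓝 0) (𝓝 x) := by
    simpa using (hline 0).continuousAt.tendsto
  have hg : ∀ᶠ s : ℝ in 𝓝 0, HasDerivAt (fun s : ℝ => f (x + s • e)) (f' (x + s • e) e) s := by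
    filter_upwards [hcont.eventually h1] with s hs
    exact hs.comp_hasDerivAt s (hline s)
  have hd : deriv (fun s : ℝ => f (x + s • e)) =ᶠ[𝓝 0] fun s => f' (x + s • e) e :=
    hg.mono fun s hs => hs.deriv
  have hdd : deriv (deriv (fun s : ℝ => f (x + s • e))) 0 = f'' e e := by
    rw [hd.deriv_eq]
    have h3 : HasFDerivAt f' f'' (x + (0 : ℝ) • e) := by simpa using h2
    have h4 : HasDerivAt (fun s : ℝ => f' (x + s • e)) (f'' e) 0 :=
      h3.comp_hasDerivAt 0 (hline 0)
    have h5 : HasDerivAt (fun s : ℝ => f' (x + s • e) e) (f'' e e) 0 :=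
      (ContinuousLinearMap.apply ℝ ℝ e).hasFDerivAt.comp_hasDerivAt 0 h4
    exact h5.deriv
  have hmax : IsLocalMax (fun s : ℝ => f (x + s • e)) 0 := by
    have : f (x + (0 : ℝ) • e) = f x := by simp
    filter_upwards [hcont.eventually hx] with s hs
    rw [this]
    exact hs
  -- A positive second derivative would make the maximum also a local minimum; the function would be
  -- locally constant along the line, with vanishing second derivative.
  have hmin := isLocalMin_of_deriv_deriv_pos (by rw [hdd]; exact hpos) hmax.deriv_eq_zero
    hg.self_of_nhds.continuousAt
  have hconst : (fun s : ℝ => f (x + s • e)) =ᶠ[𝓝 0] fun _ => f (x + (0 : ℝ) • e) := by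
    filter_upwards [hmin, hmax] with s h3 h4
    exact le_antisymm h4 h3
  have h5 : deriv (fun s : ℝ => f (x + s • e)) =ᶠ[𝓝 0] fun _ => (0 : ℝ) := by
    refine hconst.deriv.trans ?_
    simp
  have h6 : deriv (deriv (fun s : ℝ => f (x + s • e))) 0 = 0 := by
    rw [h5.deriv_eq]
    simp
  rw [hdd] at h6
  exact hpos.ne' h6

end HasLap

/-- The Laplacian of a radial function. -/
lemma hasLap_radial {ψ ψ' : ℝ → ℝ} {ψ'' : ℝ} (x : E)
    (h : ∀ᶠ q in 𝓝 (‖x‖ ^ 2), HasDerivAt ψ (ψ' q) q) (h' : HasDerivAt ψ' ψ'' (‖x‖ ^ 2)) :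
    HasLap (fun y => ψ (‖y‖ ^ 2)) x
      (2 * Module.finrank ℝ E * ψ' (‖x‖ ^ 2) + 4 * ‖x‖ ^ 2 * ψ'') := by
  have hq : ∀ y : E, HasFDerivAt (fun y : E => ‖y‖ ^ 2) (2 • innerSL ℝ y) y := fun y =>
    (hasStrictFDerivAt_norm_sq y).hasFDerivAt
  refine ⟨fun y => ψ' (‖y‖ ^ 2) • (2 • innerSL ℝ y),
    ψ' (‖x‖ ^ 2) • (2 • innerSL ℝ) + (ψ'' • (2 • innerSL ℝ x)).smulRight (2 • innerSL ℝ x),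
    ?_, ?_, ?_⟩
  · filter_upwards [(by fun_prop : Continuous fun y : E => ‖y‖ ^ 2).continuousAt.eventually h]
      with y hy
    exact hy.comp_hasFDerivAt y (hq y)
  · have h1 : HasFDerivAt (fun y : E => 2 • innerSL ℝ y) (2 • innerSL ℝ) x :=
      (2 • innerSL ℝ (E := E)).hasFDerivAt
    exact (h'.comp_hasFDerivAt x (hq x)).smul h1
  · have h2 : ∑ i, ⟪x, stdOrthonormalBasis ℝ E i⟫_ℝ ^ 2 = ‖x‖ ^ 2 :=
      (stdOrthonormalBasis ℝ E).sum_sq_inner_left x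
    rw [lap_apply]
    refine (Finset.sum_congr rfl (g := fun i => 2 * ψ' (‖x‖ ^ 2) +
      4 * ψ'' * ⟪x, stdOrthonormalBasis ℝ E i⟫_ℝ ^ 2) fun i _ => ?_).trans ?_
    · have h4 : ⟪stdOrthonormalBasis ℝ E i, stdOrthonormalBasis ℝ E i⟫_ℝ = 1 := by
        rw [real_inner_self_eq_norm_sq, (stdOrthonormalBasis ℝ E).orthonormal.norm_eq_one]
        norm_num
      simp only [_root_.add_apply, _root_.smul_apply, ContinuousLinearMap.smulRight_apply,
        smul_eq_mul, nsmul_eq_mul]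
      erw [innerSL_apply_apply, innerSL_apply_apply]
      rw [h4]
      push_cast
      ring
    · rw [Finset.sum_add_distrib, ← Finset.mul_sum _ _ (4 * ψ''), h2, Finset.sum_const, Finset.card_univ,
        Fintype.card_fin, nsmul_eq_mul]
      ring

/-- The weak maximum principle for strict subsolutions on a cylinder. -/
theorem maximum_principle {T R : ℝ} {w : ℝ → E → ℝ}
    (hw : ContinuousOn (fun q : ℝ × E => w q.1 q.2) (Icc 0 T ×ˢ Metric.closedBall 0 R))
    (h0 : ∀ x ∈ Metric.closedBall (0 : E) R, w 0 x ≤ 0)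
    (hR : ∀ t ∈ Icc 0 T, ∀ x, ‖x‖ = R → w t x ≤ 0)
    (h : ∀ t ∈ Ioc 0 T, ∀ x ∈ Metric.ball (0 : E) R, 0 < w t x →
      ∃ τ l, HasDerivAt (fun s => w s x) τ t ∧ HasLap (w t) x l ∧ τ < l)
    {t : ℝ} (ht : t ∈ Icc 0 T) {x : E} (hx : x ∈ Metric.closedBall 0 R) : w t x ≤ 0 := by
  obtain ⟨⟨t₀, x₀⟩, ⟨ht₀, hx₀⟩, hmax⟩ := (isCompact_Icc.prod
    (isCompact_closedBall (0 : E) R)).exists_isMaxOn ⟨(t, x), ht, hx⟩ hw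
  have ht₀ : t₀ ∈ Icc 0 T := ht₀
  have hx₀ : x₀ ∈ Metric.closedBall 0 R := hx₀
  by_contra! hpos
  have hpos₀ : 0 < w t₀ x₀ := hpos.trans_le (hmax (show (t, x) ∈ _ from ⟨ht, hx⟩))
  have ht0 : 0 < t₀ := by
    refine lt_of_le_of_ne ht₀.1 fun h1 => ?_
    rw [← h1] at hpos₀
    exact hpos₀.not_ge (h0 x₀ hx₀)
  have hxR : x₀ ∈ Metric.ball 0 R := by
    rw [mem_ball_zero_iff]
    rw [mem_closedBall_zero_iff] at hx₀
    exact lt_of_le_of_ne hx₀ fun h1 => hpos₀.not_ge (hR t₀ ht₀ x₀ h1)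
  obtain ⟨τ, l, hτ, hl, hlt⟩ := h t₀ ⟨ht0, ht₀.2⟩ x₀ hxR hpos₀
  have h1 : l ≤ 0 := by
    refine hl.nonpos_of_isLocalMax ?_
    filter_upwards [Metric.isOpen_ball.mem_nhds hxR] with y hy
    exact hmax (show (t₀, y) ∈ _ from ⟨ht₀, Metric.ball_subset_closedBall hy⟩)
  have h2 : 0 ≤ τ := by
    -- The maximum may lie at the final time `T`, so only left difference quotients are usable.
    have h3 := (hasDerivAt_iff_tendsto_slope.1 hτ).mono_left
      (nhdsWithin_mono t₀ (fun s (hs : s ∈ Iio t₀) => ne_of_lt hs))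
    refine ge_of_tendsto h3 ?_
    filter_upwards [self_mem_nhdsWithin, mem_nhdsWithin_of_mem_nhds (lt_mem_nhds ht0)] with s hs hs'
    rw [slope_def_field]
    have hs : s < t₀ := hs
    have hs' : 0 < s := hs'
    have h4 : w s x₀ ≤ w t₀ x₀ :=
      hmax (show (s, x₀) ∈ _ from ⟨⟨hs'.le, hs.le.trans ht₀.2⟩, hx₀⟩)
    exact div_nonneg_of_nonpos (by linarith) (by linarith)
  linarith

/-- The constant in the blow-up barrier. -/
noncomputable def barrierConst (lam : ℝ) (d : ℕ) : ℝ := √((8 * d + 36) / lam)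

/-- `u` solves the cubic equation at the point `(t, x)`. -/
def SolvesCubicAt (lam : ℝ) (u : ℝ → E → ℝ) (t : ℝ) (x : E) : Prop :=
  ∃ l, HasDerivAt (fun s => u s x) (l - lam * u t x ^ 3) t ∧ HasLap (u t) x l

/-- The gap is `(3/4) (y - z) (y + z)²`; the constant `1/4` is attained at `z = -y`. -/
lemma cube_sub_cube_ge {y z : ℝ} (h : z ≤ y) : (y - z) ^ 3 / 4 ≤ y ^ 3 - z ^ 3 := by
  nlinarith [mul_nonneg (sub_nonneg.2 h) (sq_nonneg (y + z))]

/-- Solutions of the cubic equation with the same initial value on a ball differ by at most a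
barrier that is independent of the solutions. -/
theorem sub_le_barrier {lam : ℝ} (hlam : 0 < lam) {T R : ℝ} {u v : ℝ → E → ℝ}
    (hu : ContinuousOn (fun q : ℝ × E => u q.1 q.2) (Icc 0 T ×ˢ Metric.closedBall 0 R))
    (hv : ContinuousOn (fun q : ℝ × E => v q.1 q.2) (Icc 0 T ×ˢ Metric.closedBall 0 R))
    (h0 : ∀ x ∈ Metric.closedBall (0 : E) R, u 0 x = v 0 x)
    (hsu : ∀ t ∈ Ioc 0 T, ∀ x ∈ Metric.ball (0 : E) R, SolvesCubicAt lam u t x)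
    (hsv : ∀ t ∈ Ioc 0 T, ∀ x ∈ Metric.ball (0 : E) R, SolvesCubicAt lam v t x)
    {t : ℝ} (ht : t ∈ Icc 0 T) {x : E} (hx : ‖x‖ < R) :
    u t x - v t x ≤ barrierConst lam (Module.finrank ℝ E) * R / (R ^ 2 - ‖x‖ ^ 2) := by
  set d := Module.finrank ℝ E with hd
  set A := barrierConst lam d with hA
  have hR : 0 < R := (norm_nonneg x).trans_lt hx
  have hA0 : 0 < A := by
    rw [hA, barrierConst]
    positivity
  have hA2 : A ^ 2 * lam = 8 * d + 36 := by
    rw [hA, barrierConst, Real.sq_sqrt (by positivity)]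
    field_simp
  obtain ⟨M, hM⟩ := ((isCompact_Icc.prod (isCompact_closedBall (0 : E) R)).bddAbove_image
    (hu.sub hv))
  have hM' : ∀ s ∈ Icc 0 T, ∀ y ∈ Metric.closedBall (0 : E) R, u s y - v s y ≤ M :=
    fun s hs y hy => hM ⟨(s, y), ⟨hs, hy⟩, rfl⟩
  have hxR : ‖x‖ ^ 2 < R ^ 2 := by gcongr
  -- The comparison runs on the smaller ball `‖y‖² ≤ R² - δ`, where the barrier is finite. The first
  -- bound on `δ` keeps `x` inside; the second makes the barrier at least `|M| + 1` on the sphere,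
  -- above `u - v`.
  set δ := min ((R ^ 2 - ‖x‖ ^ 2) / 2) (A * R / (|M| + 1)) with hδ
  have hδ0 : 0 < δ := lt_min (by linarith) (by positivity)
  have hδ1 : δ ≤ (R ^ 2 - ‖x‖ ^ 2) / 2 := min_le_left _ _
  have hδ2 : δ ≤ A * R / (|M| + 1) := min_le_right _ _
  have hxx := sq_nonneg ‖x‖
  set S := √(R ^ 2 - δ) with hS
  have hS2 : S ^ 2 = R ^ 2 - δ := Real.sq_sqrt (by linarith)
  have hS0 : 0 ≤ S := Real.sqrt_nonneg _
  have hxS : ‖x‖ ≤ S := by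
    apply Real.le_sqrt_of_sq_le
    linarith
  have hSR : S < R := by
    apply lt_of_pow_lt_pow_left₀ 2 hR.le
    linarith
  have hsub : Icc 0 T ×ˢ Metric.closedBall (0 : E) S ⊆ Icc 0 T ×ˢ Metric.closedBall 0 R :=
    prod_mono subset_rfl (Metric.closedBall_subset_closedBall hSR.le)
  have hpos : ∀ y ∈ Metric.closedBall (0 : E) S, 0 < R ^ 2 - ‖y‖ ^ 2 := by
    intro y hy
    rw [mem_closedBall_zero_iff] at hy
    have : ‖y‖ ^ 2 ≤ S ^ 2 := by gcongr
    linarith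
  have key := maximum_principle (T := T) (R := S)
    (w := fun t y => (u t y - v t y) - A * R / (R ^ 2 - ‖y‖ ^ 2)) ?_ ?_ ?_ ?_ ht
    (mem_closedBall_zero_iff.2 hxS)
  · simpa using key
  · refine ((hu.mono hsub).sub (hv.mono hsub)).sub ?_
    refine ContinuousOn.div (by fun_prop) (by fun_prop) fun q hq => (hpos q.2 hq.2).ne'
  · intro y hy
    rw [h0 y (Metric.closedBall_subset_closedBall hSR.le hy), sub_self, zero_sub, neg_nonpos]
    have := hpos y hy
    positivity
  · intro s hs y hy
    have h1 := hM' s hs y (by rw [mem_closedBall_zero_iff, hy]; exact hSR.le)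
    rw [hy, hS2, sub_sub_cancel]
    have h2 : |M| + 1 ≤ A * R / δ := by
      rw [le_div_iff₀ hδ0]
      rw [le_div_iff₀ (by positivity)] at hδ2
      linarith
    linarith [le_abs_self M]
  · intro s hs y hy hw
    have hyR : y ∈ Metric.ball (0 : E) R := Metric.ball_subset_ball hSR.le hy
    obtain ⟨l, h1, h2⟩ := hsu s hs y hyR
    obtain ⟨m, h3, h4⟩ := hsv s hs y hyR
    have hq := hpos y (Metric.ball_subset_closedBall hy)
    set q := ‖y‖ ^ 2 with hqd
    have hq0 : 0 ≤ q := by positivity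
    have h5 := hasLap_radial (ψ := fun q => A * R / (R ^ 2 - q))
      (ψ' := fun q => A * R / (R ^ 2 - q) ^ 2) (ψ'' := 2 * (A * R) / (R ^ 2 - q) ^ 3) y ?_ ?_
    · refine ⟨_, _, (h1.sub h3).sub (hasDerivAt_const s _), (h2.sub h4).sub h5, ?_⟩
      rw [← hd, ← hqd]
      set p := R ^ 2 - q with hp
      have h6 : A * R / p < u s y - v s y := by
        have : 0 < u s y - v s y - A * R / (R ^ 2 - ‖y‖ ^ 2) := hw
        linarith
      have h7 : (0 : ℝ) < A * R / p := by positivity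
      have h8 : (A * R / p) ^ 3 < (u s y - v s y) ^ 3 := by gcongr
      have h9 := cube_sub_cube_ge (y := u s y) (z := v s y) (by linarith)
      -- The barrier is a supersolution: with `R² = p + q` this reduces to `2 d p + 8 q ≤ (2 d + 9)
      -- (p + q)`, where `A² λ = 8 d + 36` enters. Strictness in the maximum principle comes from
      -- `h8`.
      have h10 : 2 * (d : ℝ) * (A * R / p ^ 2) + 4 * q * (2 * (A * R) / p ^ 3) ≤
          lam * ((A * R / p) ^ 3 / 4) := by
        have e1 : 2 * (d : ℝ) * (A * R / p ^ 2) + 4 * q * (2 * (A * R) / p ^ 3) =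
            A * R * (2 * d * p + 8 * q) / p ^ 3 := by
          field_simp
          ring
        have e2 : lam * ((A * R / p) ^ 3 / 4) = A * R * ((A ^ 2 * lam) * R ^ 2 / 4) / p ^ 3 := by
          field_simp
        rw [e1, e2, hA2]
        gcongr
        have hd0 : (0 : ℝ) ≤ d := Nat.cast_nonneg _
        have : R ^ 2 = p + q := by rw [hp]; ring
        rw [this]
        nlinarith [mul_nonneg hd0 hq0]
      nlinarith
    · have : ∀ᶠ z in 𝓝 q, z < R ^ 2 := gt_mem_nhds (by linarith)
      filter_upwards [this] with z hz
      have hz' : R ^ 2 - z ≠ 0 := by linarith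
      have := (((hasDerivAt_id z).const_sub (R ^ 2)).inv hz').const_mul (A * R)
      refine (this.congr_deriv ?_).congr_of_eventuallyEq ?_
      · simp [div_eq_mul_inv]
      · exact Eventually.of_forall fun y => by simp [div_eq_mul_inv]
    · have hz' : R ^ 2 - q ≠ 0 := hq.ne'
      have := ((((hasDerivAt_id q).const_sub (R ^ 2)).pow 2).inv (pow_ne_zero 2 hz')).const_mul
        (A * R)
      refine (this.congr_deriv ?_).congr_of_eventuallyEq ?_
      · simp
        field_simp
      · exact Eventually.of_forall fun y => by simp [div_eq_mul_inv]

/-- A smooth weight equivalent to `exp (a ‖x‖)`. -/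
noncomputable def smoothWeight (a : ℝ) (x : E) : ℝ := Real.exp (a * √(1 + ‖x‖ ^ 2))

lemma continuous_smoothWeight (a : ℝ) : Continuous (smoothWeight a : E → ℝ) := by
  unfold smoothWeight
  fun_prop

lemma exp_le_smoothWeight {a : ℝ} (ha : 0 ≤ a) (x : E) :
    Real.exp (a * ‖x‖) ≤ smoothWeight a x := by
  unfold smoothWeight
  gcongr
  apply Real.le_sqrt_of_sq_le
  linarith

lemma smoothWeight_le {a : ℝ} (ha : 0 ≤ a) (x : E) :
    smoothWeight a x ≤ Real.exp a * Real.exp (a * ‖x‖) := by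
  unfold smoothWeight
  rw [← Real.exp_add]
  have : √(1 + ‖x‖ ^ 2) ≤ 1 + ‖x‖ := by
    rw [Real.sqrt_le_left (by positivity)]
    nlinarith [norm_nonneg x]
  apply Real.exp_le_exp.2
  nlinarith

/-- With `s = √(1 + |x|²)` and `W = exp (a s)`, the Laplacian is `(a d / s + a² |x|² / s² - a |x|² /
s³) W`, where `s ≥ 1` and `|x|² ≤ s²`. Hence `exp (c t) W` with `c = a² + a d` is a supersolution of
the heat equation. -/
lemma exists_hasLap_smoothWeight {a : ℝ} (ha : 0 ≤ a) (x : E) :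
    ∃ l, HasLap (smoothWeight a) x l ∧ l ≤ (a ^ 2 + a * Module.finrank ℝ E) * smoothWeight a x := by
  set q := ‖x‖ ^ 2 with hq
  have hq0 : 0 ≤ q := by positivity
  have hs : ∀ z : ℝ, -1 < z → HasDerivAt (fun z => √(1 + z)) (1 / (2 * √(1 + z))) z := by
    intro z hz
    exact ((hasDerivAt_id z).const_add 1).sqrt (by simp only [id]; linarith)
  have hψ : ∀ z : ℝ, -1 < z → HasDerivAt (fun z => Real.exp (a * √(1 + z)))
      (Real.exp (a * √(1 + z)) * (a * (1 / (2 * √(1 + z))))) z := by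
    intro z hz
    exact ((hs z hz).const_mul a).exp
  have hsq : 0 < √(1 + q) := by positivity
  have hψ' := (hψ q (by linarith)).mul
    (((((hs q (by linarith)).const_mul 2).inv (by positivity)).const_mul a))
  have h := hasLap_radial (ψ := fun z => Real.exp (a * √(1 + z)))
    (ψ' := fun z => Real.exp (a * √(1 + z)) * (a * (1 / (2 * √(1 + z))))) (x := x)
    (by
      have : ∀ᶠ z in 𝓝 (‖x‖ ^ 2), -1 < z := lt_mem_nhds (by linarith)
      exact this.mono hψ)
    (hψ'.congr_of_eventuallyEq (Eventually.of_forall fun z => by simp))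
  refine ⟨_, h, ?_⟩
  rw [← hq]
  simp only [smoothWeight, ← hq, Pi.inv_apply]
  set s := √(1 + q) with hs'
  have hs2 : s ^ 2 = 1 + q := Real.sq_sqrt (by linarith)
  have hs1 : 1 ≤ s := by nlinarith
  set W := Real.exp (a * s)
  have hW : 0 < W := Real.exp_pos _
  set d : ℝ := (Module.finrank ℝ E : ℝ)
  have hd : 0 ≤ d := Nat.cast_nonneg _
  have e : 2 * d * (W * (a * (1 / (2 * s)))) + 4 * q * (W * (a * (1 / (2 * s))) *
      (a * (2 * s)⁻¹) + W * (a * (-(2 * (1 / (2 * s))) / (2 * s) ^ 2))) =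
      (a * d * s⁻¹ + a ^ 2 * (q / s ^ 2) - a * (q / s ^ 3)) * W := by
    field_simp
    ring
  refine (le_of_eq e).trans ?_
  have h1 : s⁻¹ ≤ 1 := inv_le_one_of_one_le₀ hs1
  have h2 : q / s ^ 2 ≤ 1 := by
    rw [hs2]
    exact div_le_one_of_le₀ (by linarith) (by linarith)
  have h3 : 0 ≤ a * (q / s ^ 3) := by positivity
  have h4 : a * d * s⁻¹ ≤ a * d * 1 := by gcongr
  have h5 : a ^ 2 * (q / s ^ 2) ≤ a ^ 2 * 1 := by gcongr
  gcongr
  linarith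

/-- A priori bound for solutions of exponential growth whose nonlinearity is dissipative. -/
theorem le_smoothWeight {a b M : ℝ} (ha : 0 ≤ a) (hM : 0 ≤ M) {u : ℝ → E → ℝ}
    (hu : ExpGrowth b u)
    (h : ∀ t, 0 < t → ∀ x, 0 < u t x →
      ∃ τ l, HasDerivAt (fun s => u s x) τ t ∧ HasLap (u t) x l ∧ τ ≤ l)
    (h0 : ∀ x, u 0 x ≤ M * smoothWeight a x) {t : ℝ} (ht : 0 ≤ t) (x : E) :
    u t x ≤ M * (Real.exp ((a ^ 2 + a * Module.finrank ℝ E) * t) * smoothWeight a x) := by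
  set c := a ^ 2 + a * Module.finrank ℝ E with hc
  -- The final `+ 1` makes the penalty a strict supersolution.
  set c' := (b + 1) ^ 2 + (b + 1) * Module.finrank ℝ E + 1 with hc'
  have hb := hu.nonneg
  have hb1 : 0 ≤ b + 1 := by linarith
  have hc0 : 0 ≤ c := by positivity
  have hc0' : 0 ≤ c' := by positivity
  have hWpos : ∀ (a : ℝ) (y : E), 0 < smoothWeight a y := fun a y => Real.exp_pos _
  obtain ⟨K, hK0, hK⟩ := hu.bound_on (isCompact_Icc (a := (0 : ℝ)) (b := t))
  -- The known growth `b` of `u` may exceed `a`. A small multiple of a weight with exponent `b + 1`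
  -- dominates `u` at infinity and disappears as `ε → 0`.
  suffices hε : ∀ ε > 0, u t x ≤ M * (Real.exp (c * t) * smoothWeight a x) +
      ε * (Real.exp (c' * t) * smoothWeight (b + 1) x) by
    have hB : 0 < Real.exp (c' * t) * smoothWeight (b + 1) x :=
      mul_pos (Real.exp_pos _) (hWpos _ _)
    refine le_of_forall_pos_le_add fun η hη => ?_
    have := hε (η / (Real.exp (c' * t) * smoothWeight (b + 1) x)) (by positivity)
    rwa [div_mul_cancel₀ _ hB.ne'] at this
  intro ε hε
  -- This gives `K ≤ ε R ≤ ε exp R`, so the penalty beats `K exp (b R)` on the sphere.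
  set R := max (‖x‖ + 1) (K / ε) with hR
  have hxR : ‖x‖ ≤ R := (by linarith : ‖x‖ ≤ ‖x‖ + 1).trans (le_max_left _ _)
  have hKR : K / ε ≤ R := le_max_right _ _
  have key := maximum_principle (T := t) (R := R) (w := fun s y =>
    (u s y - (M * Real.exp (c * s)) * smoothWeight a y) -
      (ε * Real.exp (c' * s)) * smoothWeight (b + 1) y) ?_ ?_ ?_ ?_
    ⟨ht, le_rfl⟩ (mem_closedBall_zero_iff.2 hxR)
  · rw [← mul_assoc, ← mul_assoc]
    linarith
  · have h1 := hu.cont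
    have h2 := continuous_smoothWeight (E := E) a
    have h3 := continuous_smoothWeight (E := E) (b + 1)
    fun_prop
  · intro y _
    simp only [mul_zero, Real.exp_zero, mul_one]
    have := h0 y
    have := mul_pos hε (hWpos (b + 1) y)
    linarith
  · intro s hs y hy
    have h1 := hK s hs y
    rw [hy, Real.norm_eq_abs] at h1
    have h2 := exp_le_smoothWeight hb1 y
    rw [hy, add_mul, one_mul, Real.exp_add] at h2
    have h3 : K ≤ ε * Real.exp R := by
      rw [div_le_iff₀ hε] at hKR
      nlinarith [Real.add_one_le_exp R]
    have h4 : 1 ≤ Real.exp (c' * s) := Real.one_le_exp (mul_nonneg hc0' hs.1)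
    have h5 : 0 ≤ (M * Real.exp (c * s)) * smoothWeight a y :=
      mul_nonneg (mul_nonneg hM (Real.exp_pos _).le) (hWpos _ _).le
    have h6 : u s y ≤ (ε * Real.exp (c' * s)) * smoothWeight (b + 1) y := by
      calc u s y ≤ K * Real.exp (b * R) := (le_abs_self _).trans h1
        _ ≤ (ε * Real.exp R) * Real.exp (b * R) := by gcongr
        _ = ε * 1 * (Real.exp (b * R) * Real.exp R) := by ring
        _ ≤ _ := by gcongr
    linarith
  · intro s hs y _ hw
    have hwa := hWpos a y
    have hwb := hWpos (b + 1) y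
    have h1 : 0 ≤ (M * Real.exp (c * s)) * smoothWeight a y :=
      mul_nonneg (mul_nonneg hM (Real.exp_pos _).le) hwa.le
    have h2 : 0 < (ε * Real.exp (c' * s)) * smoothWeight (b + 1) y :=
      mul_pos (mul_pos hε (Real.exp_pos _)) hwb
    obtain ⟨τ, l, hτ, hl, hle⟩ := h s hs.1 y (by linarith)
    obtain ⟨l₁, hl₁, hle₁⟩ := exists_hasLap_smoothWeight ha y
    obtain ⟨l₂, hl₂, hle₂⟩ := exists_hasLap_smoothWeight hb1 y
    have hexp : ∀ k : ℝ, HasDerivAt (fun s => Real.exp (k * s)) (Real.exp (k * s) * k) s := by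
      intro k
      simpa using ((hasDerivAt_id s).const_mul k).exp
    refine ⟨_, _, (hτ.sub (((hexp c).const_mul M).mul_const _)).sub
      (((hexp c').const_mul ε).mul_const _),
      (hl.sub (hl₁.const_mul (M * Real.exp (c * s)))).sub
        (hl₂.const_mul (ε * Real.exp (c' * s))), ?_⟩
    have h3 : M * Real.exp (c * s) * l₁ ≤ M * (Real.exp (c * s) * c) * smoothWeight a y := by
      have : M * Real.exp (c * s) * l₁ ≤ M * Real.exp (c * s) * (c * smoothWeight a y) := by
        gcongr
      linarith
    have h4 : ε * Real.exp (c' * s) * l₂ <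
        ε * (Real.exp (c' * s) * c') * smoothWeight (b + 1) y := by
      have : ε * Real.exp (c' * s) * l₂ ≤
          ε * Real.exp (c' * s) * ((c' - 1) * smoothWeight (b + 1) y) := by
        gcongr
        rw [hc', add_sub_cancel_right]
        exact hle₂
      linarith
    linarith

end MaximumPrinciple

/-! ### Global mild solutions for Lipschitz nonlinearities. -/

section Picard

variable {E : Type*} [NormedAddCommGroup E] [InnerProductSpace ℝ E] [FiniteDimensional ℝ E]
  [MeasurableSpace E] [BorelSpace E]
  {G : Type*} [NormedAddCommGroup G] [NormedSpace ℝ G]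
  {P : Type*} [TopologicalSpace P]

variable (E) in
/-- An exponential moment of the standard Gaussian measure. -/
noncomputable def gaussMoment : ℝ := ∫ z : E, Real.exp (‖z‖ ^ 2 / 4) ∂(stdGaussian E)

lemma gaussMoment_nonneg : 0 ≤ gaussMoment E := integral_nonneg fun _ => (Real.exp_pos _).le

/-- Young's inequality `a |r| ‖z‖ ≤ a² r² + ‖z‖² / 4` separates the parameters from the Gaussian
variable, so the moment is the same for all `a` and `r`. -/
lemma norm_heat_le {f : E → G} {M a : ℝ} (ha : 0 ≤ a) (h : ∀ x, ‖f x‖ ≤ M * Real.exp (a * ‖x‖))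
    (r : ℝ) (x : E) :
    ‖heat r f x‖ ≤ M * Real.exp (a ^ 2 * r ^ 2) * gaussMoment E * Real.exp (a * ‖x‖) := by
  have hi : Integrable (fun z : E => Real.exp (‖z‖ ^ 2 / 4)) (stdGaussian E) := by
    simpa using integrable_exp_stdGaussian_sq (E := E) 0
  have hM : 0 ≤ M := by simpa using (norm_nonneg _).trans (h 0)
  have h1 := norm_integral_le_of_norm_le
    (hi.const_mul (M * Real.exp (a ^ 2 * r ^ 2) * Real.exp (a * ‖x‖)))
    (f := fun z => f (x + r • z)) (Eventually.of_forall fun z => ?_)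
  · refine h1.trans (le_of_eq ?_)
    rw [integral_const_mul, gaussMoment]
    ring
  · refine (h _).trans ?_
    rw [mul_assoc, mul_assoc, ← Real.exp_add, ← Real.exp_add]
    gcongr
    have h2 : ‖x + r • z‖ ≤ ‖x‖ + |r| * ‖z‖ := by
      refine (norm_add_le _ _).trans ?_
      rw [norm_smul, Real.norm_eq_abs]
    have h3 := sq_abs r
    nlinarith [sq_nonneg (a * |r| - ‖z‖ / 2), mul_le_mul_of_nonneg_left h2 ha]

/-- The rate `2 a²` pays for the growth of the heat operator in the weighted norm. The extra rate
`κ` leaves `∫ 2 t θ exp (-κ t θ²) dθ ≤ 1/κ`, small uniformly in `t`, which gives a contraction on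
all times at once. -/
lemma norm_duhamel_le {F : ℝ → E → G} {M a κ t : ℝ} (ha : 0 ≤ a) (hκ : 0 < κ) (hM : 0 ≤ M)
    (ht : 0 ≤ t) (h : ∀ s ∈ Icc 0 t, ∀ y,
      ‖F s y‖ ≤ M * Real.exp ((2 * a ^ 2 + κ) * s + a * ‖y‖)) (x : E) :
    ‖duhamel F t x‖ ≤
      M * gaussMoment E / κ * Real.exp ((2 * a ^ 2 + κ) * t + a * ‖x‖) := by
  set B := M * gaussMoment E * Real.exp ((2 * a ^ 2 + κ) * t + a * ‖x‖) with hB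
  have hB0 : 0 ≤ B := mul_nonneg (mul_nonneg hM gaussMoment_nonneg) (Real.exp_pos _).le
  have hc : Continuous fun θ : ℝ => B * (2 * t * θ * Real.exp (-κ * t * θ ^ 2)) := by fun_prop
  have h1 : ‖duhamel F t x‖ ≤ ∫ θ in (0 : ℝ)..1, B * (2 * t * θ * Real.exp (-κ * t * θ ^ 2)) := by
    refine intervalIntegral.norm_integral_le_of_norm_le zero_le_one
      (Eventually.of_forall fun θ hθ => ?_) (hc.intervalIntegrable 0 1)
    have hθ0 : 0 < θ := hθ.1
    have hs : t * (1 - θ ^ 2) ∈ Icc 0 t := by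
      constructor
      · exact mul_nonneg ht (by nlinarith [hθ.1, hθ.2])
      · nlinarith [mul_nonneg ht (sq_nonneg θ)]
    have h2 := norm_heat_le (f := F (t * (1 - θ ^ 2)))
      (M := M * Real.exp ((2 * a ^ 2 + κ) * (t * (1 - θ ^ 2)))) ha (fun y => by
        rw [mul_assoc, ← Real.exp_add]
        exact h _ hs y) (√(2 * t) * θ) x
    rw [mul_pow, Real.sq_sqrt (by positivity)] at h2
    rw [norm_smul, Real.norm_eq_abs, abs_of_nonneg (by positivity)]
    calc _ ≤ 2 * t * θ * (M * Real.exp ((2 * a ^ 2 + κ) * (t * (1 - θ ^ 2))) *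
          Real.exp (a ^ 2 * (2 * t * θ ^ 2)) * gaussMoment E * Real.exp (a * ‖x‖)) := by gcongr
      _ = 2 * t * θ * M * gaussMoment E * (Real.exp ((2 * a ^ 2 + κ) * (t * (1 - θ ^ 2))) *
          Real.exp (a ^ 2 * (2 * t * θ ^ 2)) * Real.exp (a * ‖x‖)) := by ring
      _ = 2 * t * θ * M * gaussMoment E * (Real.exp ((2 * a ^ 2 + κ) * t + a * ‖x‖) *
          Real.exp (-κ * t * θ ^ 2)) := by
        simp only [← Real.exp_add]
        ring_nf
      _ = _ := by rw [hB]; ring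
  have h3 : ∫ θ in (0 : ℝ)..1, 2 * t * θ * Real.exp (-κ * t * θ ^ 2) ≤ 1 / κ := by
    have hd : ∀ θ ∈ uIcc (0 : ℝ) 1, HasDerivAt (fun θ : ℝ => -(1 / κ) * Real.exp (-κ * t * θ ^ 2))
        (2 * t * θ * Real.exp (-κ * t * θ ^ 2)) θ := by
      intro θ _
      have := ((((hasDerivAt_id θ).pow 2).const_mul (-κ * t)).exp).const_mul (-(1 / κ))
      refine this.congr_deriv ?_
      simp
      field_simp
    rw [intervalIntegral.integral_eq_sub_of_hasDerivAt hd
      ((by fun_prop : Continuous fun θ : ℝ => 2 * t * θ * Real.exp (-κ * t * θ ^ 2)).intervalIntegrable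
        0 1)]
    have : 0 ≤ 1 / κ * Real.exp (-κ * t * 1 ^ 2) := by positivity
    simp only [ne_eq, OfNat.ofNat_ne_zero, not_false_eq_true, zero_pow, mul_zero, Real.exp_zero]
    linarith
  refine h1.trans ?_
  rw [intervalIntegral.integral_const_mul]
  refine (mul_le_mul_of_nonneg_left h3 hB0).trans (le_of_eq ?_)
  rw [hB]
  ring

lemma ExpGrowth.neg {b : ℝ} {F : P → E → G} (hF : ExpGrowth b F) :
    ExpGrowth b (fun p x => -F p x) := by
  simpa using hF.clm_comp (-ContinuousLinearMap.id ℝ G)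

lemma ExpGrowth.sub {b : ℝ} {F F' : P → E → G} (hF : ExpGrowth b F) (hF' : ExpGrowth b F') :
    ExpGrowth b (fun p x => F p x - F' p x) := by
  simpa [sub_eq_add_neg] using hF.add hF'.neg

lemma ExpGrowth.duhamel_sub {b : ℝ} {F F' : ℝ → E → G} (hF : ExpGrowth b F)
    (hF' : ExpGrowth b F') (t : ℝ) (x : E) :
    duhamel (fun s y => F s y - F' s y) t x = duhamel F t x - duhamel F' t x := by
  have h1 : ∀ {F : ℝ → E → G}, ExpGrowth b F → Continuous fun θ : ℝ =>
      (2 * t * θ) • heat (√(2 * t) * θ) (F (t * (1 - θ ^ 2))) x := fun hF =>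
    (((hF.comp (φ := fun θ : ℝ => t * (1 - θ ^ 2)) (by fun_prop)).to_heat
      (ρ := fun θ => √(2 * t) * θ) (by fun_prop)).smul
      (c := fun θ => 2 * t * θ) (by fun_prop)).cont_left x
  rw [duhamel, duhamel, duhamel, ← intervalIntegral.integral_sub ((h1 hF).intervalIntegrable 0 1)
    ((h1 hF').intervalIntegrable 0 1)]
  refine intervalIntegral.integral_congr fun θ _ => ?_
  rw [← smul_sub]
  congr 1
  exact integral_sub (hF.integrable_shift _ _ x) (hF'.integrable_shift _ _ x)

/-- Global mild solutions for globally Lipschitz nonlinearities. -/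
theorem exists_mild_solution {f : ℝ → ℝ} {L : ℝ} (hL : 0 ≤ L)
    (hf : ∀ y z, |f y - f z| ≤ L * |y - z|) (hf0 : f 0 = 0) {a M : ℝ} (ha : 0 ≤ a) {u₀ : E → ℝ}
    (hu₀ : Continuous u₀) (hM : ∀ x, |u₀ x| ≤ M * Real.exp (a * ‖x‖)) :
    ∃ u : ℝ → E → ℝ, ExpGrowth a u ∧ u 0 = u₀ ∧ (∀ t, u t = u (max t 0)) ∧
      ∀ t, 0 ≤ t → ∀ x, u t x = heat (√(2 * t)) (u 0) x + duhamel (fun s y => f (u s y)) t x := by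
  have hfc : Continuous f := by
    have : LipschitzWith L.toNNReal f := by
      refine LipschitzWith.of_dist_le_mul fun y z => ?_
      rw [Real.dist_eq, Real.dist_eq, Real.coe_toNNReal _ hL]
      exact hf y z
    exact this.continuous
  have hfL : ∀ y, |f y| ≤ L * |y| := fun y => by simpa [hf0] using hf y 0
  have hM0 : 0 ≤ M := by simpa using (abs_nonneg _).trans (hM 0)
  set C := gaussMoment E with hC
  have hC0 : 0 ≤ C := gaussMoment_nonneg
  -- Chosen so that `L C / κ ≤ 1/2`, the contraction constant.
  set κ := 2 * C * L + 1 with hκ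
  have hκ0 : 0 < κ := by positivity
  set γ := 2 * a ^ 2 + κ with hγ
  -- The unknown is written as `W · v` with `v` bounded and continuous. Freezing time at `0` for
  -- negative `t` lets `v` live on all of `ℝ × E`.
  let W : ℝ × E → ℝ := fun q => Real.exp (γ * max q.1 0 + a * ‖q.2‖)
  have hW : Continuous W := by fun_prop
  have hWpos : ∀ q, 0 < W q := fun q => Real.exp_pos _
  have hu₀g : ExpGrowth a (fun _ : ℝ => u₀) :=
    ⟨ha, hu₀.comp continuous_snd, fun _ => ⟨M, Eventually.of_forall fun _ => hM⟩⟩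
  let U : BoundedContinuousFunction (ℝ × E) ℝ → ℝ → E → ℝ := fun v t x => W (t, x) * v (t, x)
  have hU : ∀ v, ExpGrowth a (U v) := by
    intro v
    have h1 : ExpGrowth a (fun (t : ℝ) x => Real.exp (a * ‖x‖) * v (t, x)) := by
      refine ⟨ha, by fun_prop, fun _ => ⟨‖v‖, Eventually.of_forall fun t x => ?_⟩⟩
      rw [norm_mul, Real.norm_eq_abs, abs_of_pos (Real.exp_pos _), mul_comm]
      gcongr
      exact v.norm_coe_le_norm _
    have h2 := h1.smul (c := fun t => Real.exp (γ * max t 0)) (by fun_prop)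
    convert h2 using 3 with t x
    simp only [U, W, smul_eq_mul, Real.exp_add]
    ring
  have hFg : ∀ v, ExpGrowth a (fun t x => f (U v t x)) := by
    intro v
    have := (hU v).comp_poly (n := 1) (C := L) hfc (fun y => by
      rw [pow_one]
      exact (hfL y).trans (by gcongr; linarith))
    simpa using this
  have hFb : ∀ v v' : BoundedContinuousFunction (ℝ × E) ℝ, ∀ s : ℝ, 0 ≤ s → ∀ y,
      ‖f (U v s y) - f (U v' s y)‖ ≤ L * ‖v - v'‖ * Real.exp (γ * s + a * ‖y‖) := by
    intro v v' s hs y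
    have h1 : |U v s y - U v' s y| ≤ Real.exp (γ * s + a * ‖y‖) * ‖v - v'‖ := by
      simp only [U, W, max_eq_left hs]
      rw [← mul_sub, abs_mul, abs_of_pos (Real.exp_pos _)]
      gcongr
      exact (v - v').norm_coe_le_norm _
    refine (hf _ _).trans ?_
    rw [mul_assoc]
    gcongr
    linarith
  have hDb : ∀ v v' : BoundedContinuousFunction (ℝ × E) ℝ, ∀ t : ℝ, 0 ≤ t → ∀ x,
      |duhamel (fun s y => f (U v s y)) t x - duhamel (fun s y => f (U v' s y)) t x| ≤
        L * ‖v - v'‖ * C / κ * Real.exp (γ * t + a * ‖x‖) := by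
    intro v v' t ht x
    rw [← (hFg v).duhamel_sub (hFg v'), ← Real.norm_eq_abs]
    exact norm_duhamel_le ha hκ0 (by positivity) ht (fun s hs y => hFb v v' s hs.1 y) x
  let T₀ : BoundedContinuousFunction (ℝ × E) ℝ → ℝ × E → ℝ := fun v q =>
    (W q)⁻¹ * (heat (√(2 * max q.1 0)) u₀ q.2 + duhamel (fun s y => f (U v s y)) (max q.1 0) q.2)
  have hT₀c : ∀ v, Continuous (T₀ v) := by
    intro v
    have h1 := ((hu₀g.to_heat (ρ := fun t => √(2 * max t 0)) (by fun_prop)).add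
      ((hFg v).to_duhamel.comp (φ := fun t : ℝ => max t 0) (by fun_prop))).cont
    exact (hW.inv₀ fun q => (hWpos q).ne').mul h1
  have hU0 : ∀ s y, U 0 s y = 0 := fun s y => by simp [U]
  have hD0 : ∀ t x, duhamel (fun s y => f (U 0 s y)) t x = 0 := by
    intro t x
    simp [hU0, hf0, duhamel, heat]
  have hT₀b : ∀ v q, ‖T₀ v q‖ ≤ M * C + L * ‖v‖ * C / κ := by
    intro v q
    have hs : 0 ≤ max q.1 0 := le_max_right _ _
    have h1 := norm_heat_le (f := u₀) ha hM (√(2 * max q.1 0)) q.2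
    rw [Real.sq_sqrt (by positivity)] at h1
    have h2 := hDb v 0 _ hs q.2
    rw [hD0, sub_zero, sub_zero] at h2
    have h3 : M * Real.exp (a ^ 2 * (2 * max q.1 0)) * C * Real.exp (a * ‖q.2‖) ≤
        M * C * Real.exp (γ * max q.1 0 + a * ‖q.2‖) := by
      have : Real.exp (a ^ 2 * (2 * max q.1 0)) * Real.exp (a * ‖q.2‖) ≤
          Real.exp (γ * max q.1 0 + a * ‖q.2‖) := by
        rw [← Real.exp_add]
        apply Real.exp_le_exp.2
        rw [hγ]
        linarith [mul_nonneg hκ0.le hs]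
      calc _ = M * C * (Real.exp (a ^ 2 * (2 * max q.1 0)) * Real.exp (a * ‖q.2‖)) := by ring
        _ ≤ _ := by gcongr
    have h4 : ‖T₀ v q‖ = (W q)⁻¹ * |heat (√(2 * max q.1 0)) u₀ q.2 +
        duhamel (fun s y => f (U v s y)) (max q.1 0) q.2| := by
      rw [Real.norm_eq_abs, abs_mul, abs_of_pos (inv_pos.2 (hWpos q))]
    rw [h4, inv_mul_le_iff₀ (hWpos q)]
    refine (abs_add_le _ _).trans ((add_le_add (h1.trans h3) h2).trans (le_of_eq ?_))
    simp only [W]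
    ring
  let T : BoundedContinuousFunction (ℝ × E) ℝ → BoundedContinuousFunction (ℝ × E) ℝ := fun v =>
    BoundedContinuousFunction.ofNormedAddCommGroup (T₀ v) (hT₀c v) _ (hT₀b v)
  have hT : ContractingWith (1 / 2) T := by
    refine ⟨by norm_num, LipschitzWith.of_dist_le_mul fun v v' => ?_⟩
    rw [dist_eq_norm, dist_eq_norm]
    refine (BoundedContinuousFunction.norm_le (by positivity)).2 fun q => ?_
    have h1 := hDb v v' _ (le_max_right q.1 0) q.2
    have h2 : (T v - T v') q = (W q)⁻¹ * (duhamel (fun s y => f (U v s y)) (max q.1 0) q.2 -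
        duhamel (fun s y => f (U v' s y)) (max q.1 0) q.2) := by
      change T₀ v q - T₀ v' q = _
      simp only [T₀]
      ring
    rw [h2, norm_mul, Real.norm_eq_abs, Real.norm_eq_abs, abs_of_pos (inv_pos.2 (hWpos q)),
      inv_mul_le_iff₀ (hWpos q)]
    refine h1.trans ?_
    have h3 : L * ‖v - v'‖ * C / κ ≤ (1 / 2) * ‖v - v'‖ := by
      rw [div_le_iff₀ hκ0, hκ]
      nlinarith [norm_nonneg (v - v')]
    calc _ ≤ (1 / 2) * ‖v - v'‖ * Real.exp (γ * max q.1 0 + a * ‖q.2‖) := by gcongr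
      _ = _ := by
        simp only [W]
        push_cast
        ring
  set v := ContractingWith.fixedPoint T hT
  have hv : T v = v := ContractingWith.fixedPoint_isFixedPt hT
  have hv' : ∀ t x, U v t x = heat (√(2 * max t 0)) u₀ x +
      duhamel (fun s y => f (U v s y)) (max t 0) x := by
    intro t x
    have h1 : v (t, x) = T₀ v (t, x) := by
      conv_lhs => rw [← hv]
      rfl
    simp only [U]
    rw [h1]
    simp only [T₀]
    rw [mul_inv_cancel_left₀ (hWpos _).ne']
  have h0 : U v 0 = u₀ := by
    ext x
    rw [hv', max_self, mul_zero, Real.sqrt_zero, heat_zero, duhamel_zero, add_zero]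
  refine ⟨U v, hU v, h0, fun t => ?_, fun t ht x => ?_⟩
  · ext x
    rw [hv', hv' (max t 0), max_eq_left (le_max_right t 0)]
  · rw [h0]
    have := hv' t x
    rwa [max_eq_left ht] at this

/-- Dominated convergence for the Duhamel integral. -/
lemma tendsto_duhamel {b : ℝ} {F : ℕ → ℝ → E → G} {F' : ℝ → E → G}
    (hF : ∀ n, ExpGrowth b (F n)) {K t : ℝ} (ht : 0 ≤ t)
    (hK : ∀ n, ∀ s ∈ Icc 0 t, ∀ y, ‖F n s y‖ ≤ K * Real.exp (b * ‖y‖))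
    (h : ∀ s ∈ Icc 0 t, ∀ y, Tendsto (fun n => F n s y) atTop (𝓝 (F' s y))) (x : E) :
    Tendsto (fun n => duhamel (F n) t x) atTop (𝓝 (duhamel F' t x)) := by
  have hb : 0 ≤ b := (hF 0).nonneg
  have hK0 : 0 ≤ K := by simpa using (norm_nonneg _).trans (hK 0 0 ⟨le_rfl, ht⟩ 0)
  set B := K * Real.exp (b ^ 2 * (2 * t)) * gaussMoment E * Real.exp (b * ‖x‖)
  have hI : uIoc (0 : ℝ) 1 = Ioc 0 1 := uIoc_of_le zero_le_one
  have hs : ∀ θ ∈ Ioc (0 : ℝ) 1, t * (1 - θ ^ 2) ∈ Icc 0 t := by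
    intro θ hθ
    constructor
    · exact mul_nonneg ht (by nlinarith [hθ.1, hθ.2])
    · nlinarith [mul_nonneg ht (sq_nonneg θ)]
  refine intervalIntegral.tendsto_integral_filter_of_dominated_convergence (fun _ => 2 * t * B)
    (Eventually.of_forall fun n => aestronglyMeasurable_of_continuous ?_)
    (Eventually.of_forall fun n => Eventually.of_forall fun θ hθ => ?_) (by simp)
    (Eventually.of_forall fun θ hθ => ?_)
  · exact ((((hF n).comp (φ := fun θ : ℝ => t * (1 - θ ^ 2)) (by fun_prop)).to_heat
      (ρ := fun θ => √(2 * t) * θ) (by fun_prop)).smul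
      (c := fun θ => 2 * t * θ) (by fun_prop)).cont_left x
  · rw [hI] at hθ
    have h1 := norm_heat_le hb (hK n _ (hs θ hθ)) (√(2 * t) * θ) x
    rw [mul_pow, Real.sq_sqrt (by positivity)] at h1
    rw [norm_smul, Real.norm_eq_abs, abs_of_nonneg (mul_nonneg (by positivity) hθ.1.le)]
    have h2 : θ ^ 2 ≤ 1 := by nlinarith [hθ.1, hθ.2]
    have h3 : K * Real.exp (b ^ 2 * (2 * t * θ ^ 2)) * gaussMoment E * Real.exp (b * ‖x‖) ≤ B := by
      have := gaussMoment_nonneg (E := E)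
      have h4 : Real.exp (b ^ 2 * (2 * t * θ ^ 2)) ≤ Real.exp (b ^ 2 * (2 * t)) :=
        Real.exp_le_exp.2 (mul_le_mul_of_nonneg_left
          (mul_le_of_le_one_right (by positivity) h2) (sq_nonneg b))
      simp only [B]
      gcongr
    have hB : 0 ≤ B := (norm_nonneg _).trans (h1.trans h3)
    calc _ ≤ 2 * t * 1 * B := by
          have := hθ.2
          have := hθ.1
          gcongr
          exact h1.trans h3
      _ = _ := by ring
  · rw [hI] at hθ
    refine Tendsto.const_smul ?_ (2 * t * θ)
    refine tendsto_integral_of_dominated_convergence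
      (fun z => K * Real.exp (b * ‖x‖) * Real.exp (b * |√(2 * t) * θ| * ‖z‖))
      (fun n => ((hF n).integrable_shift _ _ x).aestronglyMeasurable)
      ((integrable_exp_stdGaussian _).const_mul _)
      (fun n => Eventually.of_forall fun z => ExpGrowth.norm_shift_le hb (hK n _ (hs θ hθ)) le_rfl
        le_rfl z)
      (Eventually.of_forall fun z => h _ (hs θ hθ) _)

end Picard

/-! ### A globally Lipschitz truncation of the cube. -/

section Truncation

/-- The cubic nonlinearity, continued linearly outside `[-N, N]`. -/
noncomputable def cutCube (N y : ℝ) : ℝ := ∫ s in (0 : ℝ)..y, 3 * min (s ^ 2) (N ^ 2)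

lemma continuous_cutCube_integrand (N : ℝ) : Continuous fun s : ℝ => 3 * min (s ^ 2) (N ^ 2) := by
  fun_prop

lemma hasDerivAt_cutCube (N y : ℝ) : HasDerivAt (cutCube N) (3 * min (y ^ 2) (N ^ 2)) y :=
  intervalIntegral.integral_hasDerivAt_right
    ((continuous_cutCube_integrand N).intervalIntegrable _ _)
    ((continuous_cutCube_integrand N).stronglyMeasurableAtFilter _ _)
    (continuous_cutCube_integrand N).continuousAt

lemma cutCube_zero (N : ℝ) : cutCube N 0 = 0 := by simp [cutCube]

lemma cutCube_neg (N y : ℝ) : cutCube N (-y) = -cutCube N y := by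
  have := intervalIntegral.integral_comp_neg (a := 0) (b := y)
    (fun s : ℝ => 3 * min (s ^ 2) (N ^ 2))
  simp only [neg_sq, neg_zero] at this
  rw [cutCube, intervalIntegral.integral_symm, ← this, cutCube]

lemma cutCube_nonneg {N y : ℝ} (hy : 0 ≤ y) : 0 ≤ cutCube N y :=
  intervalIntegral.integral_nonneg hy fun s _ => by positivity

lemma integral_three_sq (y : ℝ) : ∫ s in (0 : ℝ)..y, 3 * s ^ 2 = y ^ 3 := by
  rw [intervalIntegral.integral_const_mul, integral_pow]
  norm_num
  ring

lemma cutCube_le {N y : ℝ} (hy : 0 ≤ y) : cutCube N y ≤ y ^ 3 := by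
  rw [← integral_three_sq]
  refine intervalIntegral.integral_mono_on hy
    ((continuous_cutCube_integrand N).intervalIntegrable _ _)
    ((by fun_prop : Continuous fun s : ℝ => 3 * s ^ 2).intervalIntegrable _ _) fun s _ => ?_
  gcongr
  exact min_le_left _ _

/-- Uniform in `N`: this is the domination used when `N → ∞` in the Duhamel term. -/
lemma abs_cutCube_le (N y : ℝ) : |cutCube N y| ≤ |y| ^ 3 := by
  rcases le_total 0 y with hy | hy
  · rw [abs_of_nonneg hy, abs_of_nonneg (cutCube_nonneg hy)]
    exact cutCube_le hy
  · have hy' : 0 ≤ -y := neg_nonneg.2 hy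
    rw [← abs_neg, ← cutCube_neg, abs_of_nonneg (cutCube_nonneg hy'), abs_of_nonpos hy]
    exact cutCube_le hy'

lemma cutCube_eq {N y : ℝ} (hy : |y| ≤ N) : cutCube N y = y ^ 3 := by
  rw [← integral_three_sq, cutCube]
  refine intervalIntegral.integral_congr fun s hs => ?_
  have h1 : |s| ≤ |y| := by
    have := abs_sub_left_of_mem_uIcc hs
    simpa using this
  have h2 : s ^ 2 ≤ N ^ 2 := sq_le_sq' (by linarith [neg_abs_le s]) (by linarith [le_abs_self s])
  rw [min_eq_left h2]

lemma abs_cutCube_sub_le (N y z : ℝ) : |cutCube N y - cutCube N z| ≤ 3 * N ^ 2 * |y - z| := by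
  have hi := (continuous_cutCube_integrand N).intervalIntegrable (μ := volume)
  rw [cutCube, cutCube, intervalIntegral.integral_interval_sub_left (hi 0 y) (hi 0 z)]
  refine intervalIntegral.norm_integral_le_of_norm_le_const (a := z) (b := y)
    (f := fun s : ℝ => 3 * min (s ^ 2) (N ^ 2)) fun s _ => ?_
  rw [Real.norm_eq_abs, abs_of_nonneg (by positivity)]
  gcongr
  exact min_le_right _ _

end Truncation

/-! ### Removing the truncation. -/

section Existence

variable {E : Type*} [NormedAddCommGroup E] [InnerProductSpace ℝ E] [FiniteDimensional ℝ E]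
  [MeasurableSpace E] [BorelSpace E]

lemma IsRegularSolution.hasLap {f : ℝ → ℝ} {u : ℝ → E → ℝ} {u' : ℝ → E → E →L[ℝ] ℝ}
    {u'' : ℝ → E → E →L[ℝ] E →L[ℝ] ℝ} (h : IsRegularSolution f u u' u'') {t : ℝ} (ht : 0 < t)
    (x : E) : HasLap (u t) x (lap (u'' t x)) :=
  ⟨u' t, u'' t x, Eventually.of_forall (h.hasFDerivAt t ht), h.hasFDerivAt_fderiv t ht x, rfl⟩

/-- Both-sided a priori bound. -/
lemma IsRegularSolution.abs_le {f : ℝ → ℝ} {u : ℝ → E → ℝ} {u' : ℝ → E → E →L[ℝ] ℝ}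
    {u'' : ℝ → E → E →L[ℝ] E →L[ℝ] ℝ} (h : IsRegularSolution f u u' u'') {a b M : ℝ} (ha : 0 ≤ a)
    (hM : 0 ≤ M) (hu : ExpGrowth b u) (hf : ∀ y, 0 < y → f y ≤ 0) (hf' : ∀ y, y < 0 → 0 ≤ f y)
    (h0 : ∀ x, |u 0 x| ≤ M * smoothWeight a x) {t : ℝ} (ht : 0 ≤ t) (x : E) :
    |u t x| ≤ M * (Real.exp ((a ^ 2 + a * Module.finrank ℝ E) * t) * smoothWeight a x) := by
  refine abs_le'.2 ⟨le_smoothWeight ha hM hu (fun s hs y hy => ?_)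
    (fun y => (le_abs_self _).trans (h0 y)) ht x,
    le_smoothWeight (u := fun t x => -u t x) ha hM hu.neg (fun s hs y hy => ?_)
    (fun y => (neg_le_abs _).trans (h0 y)) ht x⟩
  · exact ⟨_, _, h.eqn s hs y, h.hasLap hs y, by linarith [hf _ hy]⟩
  · exact ⟨_, _, (h.eqn s hs y).neg, (h.hasLap hs y).neg, by linarith [hf' _ (neg_pos.1 hy)]⟩

/-- The barrier decays like `A / R` at fixed `r`, because `R ≥ 2 r` keeps the denominator above `3
R² / 4`. -/
lemma barrier_le {A r R ε : ℝ} (hr : 0 ≤ r) (hε : 0 < ε) (hR : 0 < R)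
    (h1 : 2 * r ≤ R) (h2 : 2 * A / ε ≤ R) : A * R / (R ^ 2 - r ^ 2) ≤ ε := by
  have h3 : 4 * r ^ 2 ≤ R ^ 2 := by nlinarith
  have h4 : 0 < R ^ 2 := by positivity
  rw [div_le_iff₀ hε] at h2
  rw [div_le_iff₀ (by linarith)]
  nlinarith

/-- A global solution of the cubic equation for data of exponential growth. -/
theorem exists_cubic_solution {lam : ℝ} (hlam : 0 < lam) {a M : ℝ} (ha : 0 ≤ a) {u₀ : E → ℝ}
    (hu₀ : Continuous u₀) (hM : ∀ x, |u₀ x| ≤ M * Real.exp (a * ‖x‖)) :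
    ∃ u u' u'', IsRegularSolution (fun y => -(lam * y ^ 3)) u u' u'' ∧ u 0 = u₀ ∧
      ∀ t, 0 ≤ t → ∀ x, |u t x| ≤
        M * (Real.exp ((a ^ 2 + a * Module.finrank ℝ E) * t) * smoothWeight a x) := by
  have hM0 : 0 ≤ M := by simpa using (abs_nonneg _).trans (hM 0)
  set c := a ^ 2 + a * Module.finrank ℝ E with hc
  have hc0 : 0 ≤ c := by positivity
  have hMW : ∀ x, |u₀ x| ≤ M * smoothWeight a x := fun x =>
    (hM x).trans (by gcongr; exact exp_le_smoothWeight ha x)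
  have hex : ∀ n : ℕ, ∃ u u' u'', IsRegularSolution (E := E) (fun y => -(lam * cutCube n y)) u u' u''
      ∧ ExpGrowth a u ∧ u 0 = u₀ ∧ (∀ t, u t = u (max t 0)) ∧ ∀ t, 0 ≤ t → ∀ x,
        u t x = heat (√(2 * t)) (u 0) x + duhamel (fun s y => -(lam * cutCube n (u s y))) t x := by
    intro n
    have hL : ∀ y z, |-(lam * cutCube n y) - -(lam * cutCube n z)| ≤
        (lam * (3 * (n : ℝ) ^ 2)) * |y - z| := by
      intro y z
      have : -(lam * cutCube n y) - -(lam * cutCube n z) =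
          -(lam * (cutCube n y - cutCube n z)) := by ring
      rw [this, abs_neg, abs_mul, abs_of_pos hlam, mul_assoc]
      gcongr
      exact abs_cutCube_sub_le _ _ _
    obtain ⟨u, hu, h0, hmax, hm⟩ := exists_mild_solution (f := fun y => -(lam * cutCube n y))
      (by positivity) hL (by simp [cutCube_zero]) ha hu₀ hM
    have hreg := exists_isRegularSolution (f := fun y => -(lam * cutCube n y)) hu
      (f' := fun y => -(lam * (3 * min (y ^ 2) ((n : ℝ) ^ 2))))
      (fun y => ((hasDerivAt_cutCube n y).const_mul lam).neg) (by fun_prop)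
      (C := lam * (3 * (n : ℝ) ^ 2)) (n := 1) (C' := lam * (3 * (n : ℝ) ^ 2)) (n' := 0) ?_ ?_ hm
    · obtain ⟨u', u'', h⟩ := hreg
      exact ⟨u, u', u'', h, hu, h0, hmax, hm⟩
    · intro y
      have := hL y 0
      simp only [cutCube_zero, mul_zero, neg_zero, sub_zero] at this
      refine this.trans ?_
      rw [pow_one]
      gcongr
      linarith
    · intro y
      rw [abs_neg, abs_of_nonneg (by positivity), pow_zero, mul_one]
      gcongr
      exact min_le_right _ _
  choose u u' u'' hreg hu h0 hmax hm using hex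
  -- Independent of `n`, since the truncated cube keeps the sign of its argument.
  have hbd : ∀ n, ∀ t : ℝ, 0 ≤ t → ∀ x, |u n t x| ≤
      M * (Real.exp (c * t) * smoothWeight a x) := by
    intro n t ht x
    refine (hreg n).abs_le ha hM0 (hu n) (fun y hy => ?_) (fun y hy => ?_) (fun y => ?_) ht x
    · exact neg_nonpos.2 (mul_nonneg hlam.le (cutCube_nonneg hy.le))
    · have := cutCube_nonneg (N := n) (neg_nonneg.2 hy.le)
      rw [cutCube_neg] at this
      have := mul_nonneg hlam.le this
      linarith
    · rw [h0]
      exact hMW y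
  have hbd' : ∀ n, ∀ t T : ℝ, 0 ≤ t → t ≤ T → ∀ x, |u n t x| ≤
      M * Real.exp (c * T) * Real.exp a * Real.exp (a * ‖x‖) := by
    intro n t T ht htT x
    refine (hbd n t ht x).trans ?_
    rw [mul_assoc, mul_assoc]
    have := smoothWeight_le ha x
    have hW : 0 ≤ smoothWeight a x := (Real.exp_pos _).le
    gcongr
  have hcubic : ∀ n, ∀ t : ℝ, 0 < t → ∀ x, |u n t x| ≤ n → SolvesCubicAt lam (u n) t x := by
    intro n t ht x hx
    have h1 := (hreg n).eqn t ht x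
    rw [cutCube_eq hx, ← sub_eq_add_neg] at h1
    exact ⟨_, h1, (hreg n).hasLap ht x⟩
  -- `R` makes the barrier at most `ε` on the ball of radius `r`. `N` exceeds the uniform bound on
  -- the ball of radius `R` up to time `T`, so for `n ≥ N` the truncation is inactive there and the
  -- barrier compares two solutions of the true equation.
  have hcauchy : ∀ T r ε : ℝ, 0 ≤ T → 0 ≤ r → 0 < ε → ∃ N : ℕ, ∀ m ≥ N, ∀ n ≥ N, ∀ t ≤ T, ∀ x : E,
      ‖x‖ ≤ r → u m t x - u n t x ≤ ε := by
    intro T r ε hT hr hε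
    set A := barrierConst lam (Module.finrank ℝ E)
    have hA : 0 ≤ A := Real.sqrt_nonneg _
    set R := 2 * r + 2 * A / ε + 1 with hR
    have hAε : 0 ≤ 2 * A / ε := by positivity
    have hR0 : 0 < R := by positivity
    obtain ⟨N, hN⟩ := exists_nat_ge (M * Real.exp (c * T) * Real.exp a * Real.exp (a * R))
    have hsol : ∀ n ≥ N, ∀ t ∈ Ioc 0 T, ∀ x ∈ Metric.ball (0 : E) R,
        SolvesCubicAt lam (u n) t x := by
      intro n hn t ht x hx
      refine hcubic n t ht.1 x ((hbd' n t T ht.1.le ht.2 x).trans ?_)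
      rw [mem_ball_zero_iff] at hx
      have h1 : (N : ℝ) ≤ n := by exact_mod_cast hn
      refine le_trans ?_ (hN.trans h1)
      gcongr
    refine ⟨N, fun m hm' n hn t ht x hx => ?_⟩
    have hx' : ‖x‖ < R := by linarith
    rw [hmax m, hmax n]
    refine (sub_le_barrier hlam (T := T) (hu m).cont.continuousOn (hu n).cont.continuousOn
      (fun y _ => by rw [h0, h0]) (hsol m hm') (hsol n hn)
      ⟨le_max_right t 0, max_le ht hT⟩ hx').trans ?_
    exact barrier_le (norm_nonneg x) hε hR0 (by linarith) (by linarith)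
  have hlim : ∀ t x, ∃ l, Tendsto (fun n => u n t x) atTop (𝓝 l) := by
    intro t x
    refine cauchySeq_tendsto_of_complete (Metric.cauchySeq_iff.2 fun ε hε => ?_)
    obtain ⟨N, hN⟩ := hcauchy (max t 0) ‖x‖ (ε / 2) (le_max_right _ _) (norm_nonneg _) (half_pos hε)
    refine ⟨N, fun m hm' n hn => ?_⟩
    rw [Real.dist_eq]
    refine lt_of_le_of_lt (abs_le'.2 ⟨hN m hm' n hn t (le_max_left _ _) x le_rfl, ?_⟩)
      (half_lt_self hε)
    rw [neg_sub]
    exact hN n hn m hm' t (le_max_left _ _) x le_rfl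
  choose v hv using hlim
  have hv0 : v 0 = u₀ := by
    ext x
    refine tendsto_nhds_unique (hv 0 x) ?_
    simp only [h0]
    exact tendsto_const_nhds
  have hvbd : ∀ t : ℝ, 0 ≤ t → ∀ x, |v t x| ≤ M * (Real.exp (c * t) * smoothWeight a x) :=
    fun t ht x => le_of_tendsto (hv t x).abs (Eventually.of_forall fun n => hbd n t ht x)
  have hvcont : Continuous fun q : ℝ × E => v q.1 q.2 := by
    have hloc : TendstoLocallyUniformly (fun n (q : ℝ × E) => u n q.1 q.2)
        (fun q => v q.1 q.2) atTop := by
      rw [Metric.tendstoLocallyUniformly_iff]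
      rintro ε hε ⟨t, x⟩
      obtain ⟨N, hN⟩ := hcauchy (|t| + 1) (‖x‖ + 1) (ε / 2) (by positivity) (by positivity)
        (half_pos hε)
      refine ⟨{q | q.1 < |t| + 1 ∧ ‖q.2‖ < ‖x‖ + 1}, ?_, ?_⟩
      · have h1 : ∀ᶠ q : ℝ × E in 𝓝 (t, x), q.1 < |t| + 1 :=
          continuousAt_fst.eventually_lt continuousAt_const (by linarith [le_abs_self t])
        have h2 : ∀ᶠ q : ℝ × E in 𝓝 (t, x), ‖q.2‖ < ‖x‖ + 1 :=
          (by fun_prop : Continuous fun q : ℝ × E => ‖q.2‖).continuousAt.eventually_lt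
            continuousAt_const (by simp)
        exact h1.and h2
      · filter_upwards [eventually_ge_atTop N] with n hn q hq
        rw [Real.dist_eq]
        refine lt_of_le_of_lt (abs_le'.2 ⟨?_, ?_⟩) (half_lt_self hε)
        · refine le_of_tendsto ((hv q.1 q.2).sub_const _) ?_
          filter_upwards [eventually_ge_atTop N] with m hm'
          exact hN m hm' n hn q.1 hq.1.le q.2 hq.2.le
        · rw [neg_sub]
          refine le_of_tendsto ((hv q.1 q.2).const_sub _) ?_
          filter_upwards [eventually_ge_atTop N] with m hm'
          exact hN n hn m hm' q.1 hq.1.le q.2 hq.2.le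
    exact hloc.continuous (Frequently.of_forall fun n => (hu n).cont)
  have hvmax : ∀ t, v t = v (max t 0) := by
    intro t
    ext x
    refine tendsto_nhds_unique (hv t x) ?_
    simp_rw [fun n => hmax n t]
    exact hv _ x
  have hvg : ExpGrowth a v := by
    refine ⟨ha, hvcont, fun t => ⟨M * Real.exp (c * (|t| + 1)) * Real.exp a, ?_⟩⟩
    have h1 : ∀ᶠ s in 𝓝 t, s < |t| + 1 := gt_mem_nhds (by linarith [le_abs_self t])
    filter_upwards [h1] with s hs x
    rw [hvmax s]
    refine (hvbd _ (le_max_right s 0) x).trans ?_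
    rw [mul_assoc, mul_assoc]
    have := smoothWeight_le ha x
    have hW : 0 ≤ smoothWeight a x := (Real.exp_pos _).le
    have h2 : max s 0 ≤ |t| + 1 := max_le hs.le (by positivity)
    gcongr
  -- Passing to the limit in the mild equation needs only pointwise convergence and a growth bound
  -- with exponent `3 a`; no derivatives of the approximations have to converge.
  have hvm : ∀ t, 0 ≤ t → ∀ x, v t x = heat (√(2 * t)) (v 0) x +
      duhamel (fun s y => -(lam * v s y ^ 3)) t x := by
    intro t ht x
    refine tendsto_nhds_unique (hv t x) ?_
    simp_rw [fun n => hm n t ht x, h0, hv0]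
    refine tendsto_const_nhds.add ?_
    refine tendsto_duhamel (b := (3 : ℕ) * a)
      (K := lam * (M * Real.exp (c * t) * Real.exp a) ^ 3) (fun n => ?_) ht
      (fun n s hs y => ?_) (fun s hs y => ?_) x
    · refine (hu n).comp_poly (φ := fun y => -(lam * cutCube n y)) (C := lam) ?_ (fun y => ?_)
      · exact (continuous_const.mul (continuous_iff_continuousAt.2 fun y =>
          (hasDerivAt_cutCube n y).continuousAt)).neg
      · rw [abs_neg, abs_mul, abs_of_pos hlam]
        have := abs_cutCube_le n y
        gcongr
        refine this.trans ?_
        gcongr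
        linarith
    · rw [Real.norm_eq_abs, abs_neg, abs_mul, abs_of_pos hlam, mul_assoc ((3 : ℕ) : ℝ) a,
        Real.exp_nat_mul, mul_assoc, ← mul_pow]
      have := abs_cutCube_le n (u n s y)
      gcongr
      refine this.trans ?_
      gcongr
      exact hbd' n s t hs.1 hs.2 y
    · have h1 : Tendsto (fun n => -(lam * u n s y ^ 3)) atTop (𝓝 (-(lam * v s y ^ 3))) :=
        (((hv s y).pow 3).const_mul lam).neg
      refine h1.congr' ?_
      obtain ⟨N, hN⟩ := exists_nat_ge (M * (Real.exp (c * s) * smoothWeight a y))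
      filter_upwards [eventually_ge_atTop N] with n hn
      have h2 : (N : ℝ) ≤ n := by exact_mod_cast hn
      rw [cutCube_eq ((hbd n s hs.1 y).trans (hN.trans h2))]
  obtain ⟨v', v'', hreg'⟩ := exists_isRegularSolution (f := fun y => -(lam * y ^ 3)) hvg
    (f' := fun y => -(lam * (3 * y ^ 2)))
    (fun y => by
      have := ((hasDerivAt_pow 3 y).const_mul lam).neg
      norm_num at this
      exact this) (by fun_prop)
    (C := lam) (n := 3) (C' := lam * 3) (n' := 2)
    (fun y => by
      rw [abs_neg, abs_mul, abs_of_pos hlam, abs_pow]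
      gcongr
      linarith)
    (fun y => by
      rw [abs_neg, abs_mul, abs_of_pos hlam, abs_mul, abs_pow, abs_of_pos (three_pos), ← mul_assoc]
      gcongr
      linarith) hvm
  exact ⟨v, v', v'', hreg', hv0, hvbd⟩

end Existence

/-! ### Translation to classical solutions, and uniqueness. -/

section Classical

variable {d : ℕ}

lemma laplacian_eq_lap {f : Space d → ℝ} (x : Space d) :
    Laplacian.laplacian f x = lap (fderiv ℝ (fderiv ℝ f) x) := by
  rw [InnerProductSpace.laplacian_eq_iteratedFDeriv_stdOrthonormalBasis, lap_apply]
  refine Finset.sum_congr rfl fun i _ => ?_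
  rw [iteratedFDeriv_two_apply]
  simp

lemma IsRegularSolution.isClassicalSolution {lam : ℝ} {u : ℝ → Space d → ℝ}
    {u' : ℝ → Space d → Space d →L[ℝ] ℝ} {u'' : ℝ → Space d → Space d →L[ℝ] Space d →L[ℝ] ℝ}
    (h : IsRegularSolution (fun y => -(lam * y ^ 3)) u u' u'') :
    IsClassicalSolution lam (u 0) u := by
  have h1 : ∀ t, 0 < t → fderiv ℝ (u t) = u' t := fun t ht =>
    funext fun x => (h.hasFDerivAt t ht x).fderiv
  have h2 : ∀ t, 0 < t → fderiv ℝ (fderiv ℝ (u t)) = u'' t := fun t ht => by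
    rw [h1 t ht]
    exact funext fun x => (h.hasFDerivAt_fderiv t ht x).fderiv
  have hc : ∀ t, 0 < t → Continuous (u'' t) := fun t ht => by
    have := h.cont_fderiv2.comp (by fun_prop : Continuous fun x : Space d => (t, x)).continuousOn
      (s := univ) fun x _ => ⟨ht, mem_univ _⟩
    exact continuousOn_univ.1 this
  refine ⟨h.cont.continuousOn, fun _ => rfl, fun t ht x => (h.eqn t ht x).differentiableAt,
    ?_, fun t ht => ?_, ?_, ?_, fun t ht x => ?_⟩
  -- Continuity of the time derivative is read off from the equation.
  · have h3 : ContinuousOn (fun q : ℝ × Space d => lap (u'' q.1 q.2) + -(lam * u q.1 q.2 ^ 3))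
        (Ioi 0 ×ˢ univ) := by
      refine (lap.continuous.comp_continuousOn h.cont_fderiv2).add ?_
      have := h.cont
      fun_prop
    exact h3.congr fun q hq => (h.eqn q.1 hq.1 q.2).deriv
  · have h3 : ContDiff ℝ 1 (u' t) :=
      contDiff_one_iff_hasFDerivAt.2 ⟨u'' t, hc t ht, h.hasFDerivAt_fderiv t ht⟩
    exact contDiff_succ_iff_hasFDerivAt (n := 1) |>.2 ⟨u' t, h3, h.hasFDerivAt t ht⟩
  · exact h.cont_fderiv.congr fun q hq => congrFun (h1 q.1 hq.1) q.2
  · exact h.cont_fderiv2.congr fun q hq => congrFun (h2 q.1 hq.1) q.2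
  · rw [laplacian_eq_lap, h2 t ht, (h.eqn t ht x).deriv, ← sub_eq_add_neg]

lemma IsClassicalSolution.solvesCubicAt {lam : ℝ} {u₀ : Space d → ℝ} {u : ℝ → Space d → ℝ}
    (h : IsClassicalSolution lam u₀ u) {t : ℝ} (ht : 0 < t) (x : Space d) :
    SolvesCubicAt lam u t x := by
  have h1 := h.contDiff_space t ht
  have h2 : ContDiff ℝ 1 (fderiv ℝ (u t)) := h1.fderiv_right (by norm_num)
  refine ⟨Laplacian.laplacian (u t) x, ?_, fderiv ℝ (u t), fderiv ℝ (fderiv ℝ (u t)) x,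
    Eventually.of_forall fun y => (h1.differentiable (by norm_num) y).hasFDerivAt,
    (h2.differentiable (by norm_num) x).hasFDerivAt, (laplacian_eq_lap x).symm⟩
  rw [← h.equation t ht x]
  exact (h.differentiableAt_time t ht x).hasDerivAt

/-- Uniqueness without any growth condition at infinity. -/
lemma IsClassicalSolution.le {lam : ℝ} (hlam : 0 < lam) {u₀ : Space d → ℝ}
    {u v : ℝ → Space d → ℝ} (hu : IsClassicalSolution lam u₀ u)
    (hv : IsClassicalSolution lam u₀ v) {t : ℝ} (ht : 0 ≤ t) (x : Space d) : u t x ≤ v t x := by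
  refine le_of_forall_pos_le_add fun ε hε => ?_
  set A := barrierConst lam (Module.finrank ℝ (Space d))
  have hA : 0 ≤ A := Real.sqrt_nonneg _
  have hAε : 0 ≤ 2 * A / ε := by positivity
  have hx := norm_nonneg x
  have hsub : Icc 0 t ×ˢ Metric.closedBall (0 : Space d) (2 * ‖x‖ + 2 * A / ε + 1) ⊆
      Ici 0 ×ˢ univ := prod_mono Icc_subset_Ici_self (subset_univ _)
  -- The barrier involves neither `u` nor `v`, so the radius can be sent to infinity with no control
  -- of the solutions there.
  have h1 := sub_le_barrier hlam (T := t) (R := 2 * ‖x‖ + 2 * A / ε + 1)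
    (hu.continuousOn.mono hsub) (hv.continuousOn.mono hsub)
    (fun y _ => by rw [hu.initial, hv.initial]) (fun s hs y _ => hu.solvesCubicAt hs.1 y)
    (fun s hs y _ => hv.solvesCubicAt hs.1 y) ⟨ht, le_rfl⟩ (x := x) (by linarith)
  have h2 := barrier_le hx hε (R := 2 * ‖x‖ + 2 * A / ε + 1) (by linarith) (by linarith)
    (by linarith)
  exact sub_le_iff_le_add'.1 (h1.trans h2)

lemma abs_le_weightedNorm {a : ℝ} {f : Space d → ℝ} (hf : f ∈ weightedSpace d a) (x : Space d) :
    |f x| ≤ weightedNorm a f * Real.exp (a * ‖x‖) := by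
  have := le_ciSup hf.2 x
  rw [← div_le_iff₀ (Real.exp_pos _), div_eq_mul_inv, ← Real.exp_neg, ← neg_mul]
  exact this

end Classical

end AllenCahn

theorem lemmaB1 (d : ℕ) (a : ℝ) (ha : 0 < a) :
    ∃ C : ℝ → ℝ, ∀ lam : ℝ, 0 < lam → ∀ u₀ ∈ AllenCahn.weightedSpace d a,
      ∃ u : ℝ → AllenCahn.Space d → ℝ,
        AllenCahn.IsClassicalSolution lam u₀ u ∧
        (∀ v : ℝ → AllenCahn.Space d → ℝ, AllenCahn.IsClassicalSolution lam u₀ v →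
          ∀ t, 0 ≤ t → v t = u t) ∧
        ∀ t, 0 ≤ t → u t ∈ AllenCahn.weightedSpace d a ∧
          AllenCahn.weightedNorm a (u t) ≤ C t * AllenCahn.weightedNorm a u₀ := by
  -- The factor `exp a` is the price of replacing the smooth weight by `exp (a ‖x‖)`.
  refine ⟨fun t => Real.exp ((a ^ 2 + a * Module.finrank ℝ (AllenCahn.Space d)) * t) * Real.exp a,
    fun lam hlam u₀ hu₀ => ?_⟩
  have hM := AllenCahn.abs_le_weightedNorm hu₀
  set M := AllenCahn.weightedNorm a u₀
  have hM0 : 0 ≤ M := by simpa using (abs_nonneg _).trans (hM 0)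
  obtain ⟨u, u', u'', hreg, h0, hb⟩ := AllenCahn.exists_cubic_solution hlam ha.le hu₀.1 hM
  have hcl := hreg.isClassicalSolution
  rw [h0] at hcl
  refine ⟨u, hcl, fun v hv t ht => ?_, fun t ht => ?_⟩
  · ext x
    exact le_antisymm (hv.le hlam hcl ht x) (hcl.le hlam hv ht x)
  · have hbound : ∀ x : AllenCahn.Space d, |u t x| * Real.exp (-a * ‖x‖) ≤
        Real.exp ((a ^ 2 + a * Module.finrank ℝ (AllenCahn.Space d)) * t) * Real.exp a * M := by
      intro x
      rw [neg_mul, Real.exp_neg, ← div_eq_mul_inv, div_le_iff₀ (Real.exp_pos _)]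
      refine (hb t ht x).trans ?_
      have h1 := AllenCahn.smoothWeight_le ha.le x
      calc _ ≤ M * (Real.exp ((a ^ 2 + a * Module.finrank ℝ (AllenCahn.Space d)) * t) *
            (Real.exp a * Real.exp (a * ‖x‖))) := by gcongr
        _ = _ := by ring
    refine ⟨⟨hreg.cont.comp (by fun_prop : Continuous fun x : AllenCahn.Space d => (t, x)), _,
      Set.forall_mem_range.2 hbound⟩, ciSup_le hbound⟩
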